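/- Let $X,Y$ be finite non-empty sets and $f:X\times Y\to Z$. Al holds $x\in X$ and Bob holds $y\in Y$. *Protocols.* In a classical (randomized) protocol the players have independent private coins and exchange bits, each bit being determined by the sender's input, his coins, and the bits sent so far; the protocol is deterministic if no coins are used. In a quantum protocol each player starts with finitely many private qubits in state $|0\rangle$; in each round one player applies a unitary transformation, which may depend on his (classical, never erased) input, to the qubits he owns and then sends some of them to the other player, the schedule and the choice of qubits not depending on the inputs. At the end both players declare an output, computed from what they hold (in the quantum case after measuring their qubits). A protocol computes $h:X\times Y\to W$ with error $\varepsilon$ if on every input, with probability at least $1-\varepsilon$, both outputs equal $h(x,y)$. *Privacy.* For a distribution $\mu$ on $X\times Y$ and a time $t$ of the protocol let $A$, $B$ be what Al and Bob hold at that time besides their inputs (coins and all bits exchanged so far in the classical case, the qubits currently owned in the quantum case). The privacy loss of the protocol for $h$ is the supremum, over all $t$ and all $\mu$, of the conditional mutual informations $I(B:X\mid Y,h(X,Y))$ and $I(A:Y\mid X,h(X,Y))$ (Shannon entropy in the classical case, von Neumann entropy in the quantum case). A function $h$ is privately computable by deterministic protocols if some deterministic protocol computes it without error and has privacy loss $0$;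 it is privately computable with error $\varepsilon$ by classical (respectively quantum) protocols if some classical randomized (respectively quantum) protocol computes it with error $\varepsilon$ and has privacy loss exactly $0$. *Hint sense.* With respect to one of these three kinds of protocols, $f$ can be computed with privacy loss $k$ in the hint sense if there are a finite set $W$ and a privately computable $h:X\times Y\to W$ such that $f(x,y)$ is determined by $h(x,y)$, i.e. $f=g\circ h$ for some $g:W\to Z$, and $k=\log_2|\mathrm{range}(h)|-\log_2|\mathrm{range}(f)|$. The privacy loss of $f$ in the hint sense is the infimum of all such $k$. **Corollary.** Let $0\le\varepsilon_1,\varepsilon_2<1/2$. For every real $k$, the following are equivalent: $f$ can be computed with privacy loss $k$ in the hint sense by deterministic protocols; by classical randomized protocols with error $\varepsilon_1$; by quantum protocols with error $\varepsilon_2$. In particular the privacy loss of $f$ in the hint sense is one and the same real number for deterministic, classical randomized and quantum protocols. -/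

import Mathlib

open scoped Matrix BigOperators

noncomputable section

namespace TwoParty

universe u v w

/-! ## Entropy and conditional mutual information -/

section Information

/-- Shannon entropy (in bits) of the random variable `g` on the finite probability space `Ω` with
weights `p`. -/
def shannonEntropy {Ω S : Type*} [Fintype Ω] [DecidableEq S] (p : Ω → ℝ) (g : Ω → S) : ℝ :=
  ∑ s ∈ Finset.univ.image g, Real.negMulLog (∑ ω with g ω = s, p ω) / Real.log 2

/-- Conditional mutual information `I(V : U | Z)` of random variables on a finite space. -/
def condMutualInfo {Ω P Q R : Type*} [Fintype Ω] [DecidableEq P] [DecidableEq Q] [DecidableEq R]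
    (p : Ω → ℝ) (V : Ω → P) (U : Ω → Q) (Z : Ω → R) : ℝ :=
  shannonEntropy p (fun ω => (V ω, Z ω)) + shannonEntropy p (fun ω => (U ω, Z ω))
    - shannonEntropy p Z - shannonEntropy p (fun ω => (V ω, U ω, Z ω))

/-- Von Neumann entropy (in bits): `- ∑ λ log λ` over the multiset of all eigenvalues. -/
def vonNeumannEntropy {S : Type*} [Fintype S] [DecidableEq S] (ρ : Matrix S S ℂ) : ℝ :=
  (ρ.charpoly.roots.map fun l => Real.negMulLog l.re / Real.log 2).sum

/-- Partial trace over the first tensor factor. -/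
def traceFst {S T : Type*} [Fintype S] (ρ : Matrix (S × T) (S × T) ℂ) : Matrix T T ℂ :=
  fun i j => ∑ s, ρ (s, i) (s, j)

/-- Partial trace over the middle one of three tensor factors. -/
def traceMid {P Q R : Type*} [Fintype Q] (ρ : Matrix (P × Q × R) (P × Q × R) ℂ) :
    Matrix (P × R) (P × R) ℂ :=
  fun i j => ∑ q, ρ (i.1, q, i.2) (j.1, q, j.2)

/-- Quantum conditional mutual information `I(P : Q | R) = S(PR) + S(QR) - S(R) - S(PQR)` of a
state of three registers. -/
def qCondMutualInfo {P Q R : Type*} [Fintype P] [Fintype Q] [Fintype R]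
    [DecidableEq P] [DecidableEq Q] [DecidableEq R]
    (ρ : Matrix (P × Q × R) (P × Q × R) ℂ) : ℝ :=
  vonNeumannEntropy (traceMid ρ) + vonNeumannEntropy (traceFst ρ)
    - vonNeumannEntropy (traceFst (traceFst ρ)) - vonNeumannEntropy ρ

end Information

/-! ## Classical randomized protocols -/

section Classical

/-- A protocol tree. Al (input in `X`, private coin outcome in `RA`) and Bob (input in `Y`, private
coin outcome in `RB`) exchange bits. Whose turn it is, and how the bit to be sent is computed, is
determined by the bits sent so far, i.e. by the position in the tree. At a leaf each of the players
declares an output. -/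
inductive ProtocolTree (X : Type u) (Y : Type v) (W : Type w) (RA RB : Type) :
    Type (max u v w) where
  | output (outA : X → RA → W) (outB : Y → RB → W)
  | al (bit : X → RA → Bool) (next : Bool → ProtocolTree X Y W RA RB)
  | bob (bit : Y → RB → Bool) (next : Bool → ProtocolTree X Y W RA RB)

variable {X : Type u} {Y : Type v} {W : Type w}

/-- The sequence of bits sent when the protocol runs on the given inputs and coins. -/
def ProtocolTree.transcript {RA RB : Type} (x : X) (y : Y) (ra : RA) (rb : RB) :
    ProtocolTree X Y W RA RB → List Bool
  | .output _ _ => []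
  | .al bit next => bit x ra :: (next (bit x ra)).transcript x y ra rb
  | .bob bit next => bit y rb :: (next (bit y rb)).transcript x y ra rb

/-- The outputs of Al and of Bob. -/
def ProtocolTree.outputs {RA RB : Type} (x : X) (y : Y) (ra : RA) (rb : RB) :
    ProtocolTree X Y W RA RB → W × W
  | .output outA outB => (outA x ra, outB y rb)
  | .al bit next => (next (bit x ra)).outputs x y ra rb
  | .bob bit next => (next (bit y rb)).outputs x y ra rb

/-- A classical randomized protocol with private coins: the coin outcomes of Al and Bob are drawn
independently from the distributions `pA` and `pB`. -/
structure ClassicalProtocol (X : Type u) (Y : Type v) (W : Type w) where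
  rA : ℕ
  rB : ℕ
  pA : stdSimplex ℝ (Fin rA)
  pB : stdSimplex ℝ (Fin rB)
  tree : ProtocolTree X Y W (Fin rA) (Fin rB)

/-- A deterministic protocol is one in which the coins have a single outcome. -/
def ClassicalProtocol.IsDeterministic (P : ClassicalProtocol X Y W) : Prop :=
  P.rA = 1 ∧ P.rB = 1

variable [DecidableEq W]

/-- The protocol computes `h` with error `ε`: on every input, both players output the right value
with probability at least `1 - ε`. -/
def ClassicalProtocol.Computes (P : ClassicalProtocol X Y W) (ε : ℝ) (h : X → Y → W) : Prop :=
  ∀ x y, 1 - ε ≤ ∑ ra, ∑ rb,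
    if P.tree.outputs x y ra rb = (h x y, h x y) then P.pA.1 ra * P.pB.1 rb else 0

variable [Fintype X] [Fintype Y] [DecidableEq X] [DecidableEq Y]

/-- The joint distribution of inputs and coins when the inputs are drawn from `μ`. -/
def ClassicalProtocol.joint (P : ClassicalProtocol X Y W) (μ : stdSimplex ℝ (X × Y)) :
    X × Y × Fin P.rA × Fin P.rB → ℝ :=
  fun ω => μ.1 (ω.1, ω.2.1) * P.pA.1 ω.2.2.1 * P.pB.1 ω.2.2.2

/-- `I(B : X | Y, h(X,Y))` after `t` bits of communication, where `B` consists of Bob's coins and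
of the bits exchanged so far. -/
def ClassicalProtocol.divulgedToBob (P : ClassicalProtocol X Y W) (h : X → Y → W) (t : ℕ)
    (μ : stdSimplex ℝ (X × Y)) : ℝ :=
  condMutualInfo (P.joint μ)
    (fun ω => (ω.2.2.2, (P.tree.transcript ω.1 ω.2.1 ω.2.2.1 ω.2.2.2).take t))
    (fun ω => ω.1) (fun ω => (ω.2.1, h ω.1 ω.2.1))

/-- `I(A : Y | X, h(X,Y))` after `t` bits of communication, where `A` consists of Al's coins and
of the bits exchanged so far. -/
def ClassicalProtocol.divulgedToAl (P : ClassicalProtocol X Y W) (h : X → Y → W) (t : ℕ)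
    (μ : stdSimplex ℝ (X × Y)) : ℝ :=
  condMutualInfo (P.joint μ)
    (fun ω => (ω.2.2.1, (P.tree.transcript ω.1 ω.2.1 ω.2.2.1 ω.2.2.2).take t))
    (fun ω => ω.2.1) (fun ω => (ω.1, h ω.1 ω.2.1))

/-- The privacy loss of a classical protocol for `h`: the supremum of the divulged information over
all times, both players, and all distributions on the inputs. -/
def ClassicalProtocol.privacyLoss (P : ClassicalProtocol X Y W) (h : X → Y → W) : EReal :=
  ⨆ (t : ℕ) (μ : stdSimplex ℝ (X × Y)),
    max (P.divulgedToBob h t μ : EReal) (P.divulgedToAl h t μ : EReal)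

end Classical

/-! ## Quantum protocols -/

section Quantum

/-- A vector in the space of `a` qubits of Al and `b` qubits of Bob, in the computational basis. -/
abbrev QState (a b : ℕ) : Type := (Fin a → Bool) → (Fin b → Bool) → ℂ

/-- Unitary operators on `n` qubits. -/
abbrev QUnitary (n : ℕ) : Type := Matrix.unitaryGroup (Fin n → Bool) ℂ

/-- A quantum protocol from a point at which Al owns `a` qubits and Bob owns `b` qubits.
In a round of Al he applies a unitary operator, which depends on his (classical, never erased)
input, to all qubits that he owns, and then sends some of them to Bob: `e` says which `m` of his
qubits are sent and which `k` are kept. Similarly for Bob. At the end both players measure their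
qubits in the computational basis and compute an output from input and measurement result. -/
inductive QuantumRounds (X : Type u) (Y : Type v) (W : Type w) :
    ℕ → ℕ → Type (max u v w) where
  | output {a b : ℕ} (outA : X → (Fin a → Bool) → W) (outB : Y → (Fin b → Bool) → W) :
      QuantumRounds X Y W a b
  | al {a b k m : ℕ} (U : X → QUnitary a) (e : Fin a ≃ Fin m ⊕ Fin k)
      (next : QuantumRounds X Y W k (m + b)) : QuantumRounds X Y W a b
  | bob {a b k m : ℕ} (U : Y → QUnitary b) (e : Fin b ≃ Fin m ⊕ Fin k)
      (next : QuantumRounds X Y W (m + a) k) : QuantumRounds X Y W a b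

/-- Al applies `U` to his qubits. -/
def applyAl {a b : ℕ} (U : QUnitary a) (ψ : QState a b) : QState a b :=
  fun α β => ∑ α', U.1 α α' * ψ α' β

/-- Bob applies `U` to his qubits. -/
def applyBob {a b : ℕ} (U : QUnitary b) (ψ : QState a b) : QState a b :=
  fun α β => ∑ β', U.1 β β' * ψ α β'

/-- Al hands the qubits selected by `e` over to Bob, in front of Bob's own qubits. The overall
superposition does not change, only the ownership. -/
def sendAl {a b k m : ℕ} (e : Fin a ≃ Fin m ⊕ Fin k) (ψ : QState a b) : QState k (m + b) :=
  fun α β => ψ (fun i => Sum.elim (fun j => β (Fin.castAdd b j)) α (e i))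
    (fun j => β (Fin.natAdd m j))

/-- Bob hands the qubits selected by `e` over to Al, in front of Al's own qubits. -/
def sendBob {a b k m : ℕ} (e : Fin b ≃ Fin m ⊕ Fin k) (ψ : QState a b) : QState (m + a) k :=
  fun α β => ψ (fun j => α (Fin.natAdd m j))
    (fun i => Sum.elim (fun j => α (Fin.castAdd a j)) β (e i))

/-- The state in which all qubits are `|0⟩`. -/
def initialState (a b : ℕ) : QState a b :=
  fun α β => if α = (fun _ => false) ∧ β = (fun _ => false) then 1 else 0

/-- The reduced density matrix of Al's qubits. -/
def reducedAl {a b : ℕ} (ψ : QState a b) : Matrix (Fin a → Bool) (Fin a → Bool) ℂ :=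
  fun α α' => ∑ β, ψ α β * star (ψ α' β)

/-- The reduced density matrix of Bob's qubits. -/
def reducedBob {a b : ℕ} (ψ : QState a b) : Matrix (Fin b → Bool) (Fin b → Bool) ℂ :=
  fun β β' => ∑ α, ψ α β * star (ψ α β')

variable {X : Type u} {Y : Type v} {W : Type w}

/-- The probability that both players output `z` when the rest of the protocol is run on inputs
`x, y` from the state `ψ`. -/
def QuantumRounds.successProb [DecidableEq W] (x : X) (y : Y) (z : W) :
    {a b : ℕ} → QuantumRounds X Y W a b → QState a b → ℝ
  | _, _, .output outA outB, ψ =>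
      ∑ α, ∑ β, if outA x α = z ∧ outB y β = z then ‖ψ α β‖ ^ 2 else 0
  | _, _, .al U e next, ψ => next.successProb x y z (sendAl e (applyAl (U x) ψ))
  | _, _, .bob U e next, ψ => next.successProb x y z (sendBob e (applyBob (U y) ψ))

variable [Fintype X] [Fintype Y] [Fintype W] [DecidableEq X] [DecidableEq Y] [DecidableEq W]

/-- The state `∑ μ(x,y) σ_{xy} ⊗ |x⟩⟨x| ⊗ |y, h(x,y)⟩⟨y, h(x,y)|` of the registers
`B, X, (Y, h(X,Y))` when `B` is in state `σ_{xy}` on inputs `x, y`. -/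
def cqState {B : Type*} (σ : X → Y → Matrix B B ℂ) (h : X → Y → W) (μ : X → Y → ℝ) :
    Matrix (B × X × Y × W) (B × X × Y × W) ℂ :=
  fun i j => if i.2 = j.2 ∧ i.2.2.2 = h i.2.1 i.2.2.1 then
    (μ i.2.1 i.2.2.1 : ℂ) * σ i.2.1 i.2.2.1 i.1 j.1 else 0

/-- `I(B : X | Y, h(X,Y))` for inputs drawn from `μ`, when the qubits are in the pure state `Ψ x y`
on inputs `x, y`. -/
def qDivulgedToBob {a b : ℕ} (Ψ : X → Y → QState a b) (h : X → Y → W)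
    (μ : stdSimplex ℝ (X × Y)) : ℝ :=
  qCondMutualInfo (cqState (fun x y => reducedBob (Ψ x y)) h fun x y => μ.1 (x, y))

/-- `I(A : Y | X, h(X,Y))` for inputs drawn from `μ`, when the qubits are in the pure state `Ψ x y`
on inputs `x, y`. -/
def qDivulgedToAl {a b : ℕ} (Ψ : X → Y → QState a b) (h : X → Y → W)
    (μ : stdSimplex ℝ (X × Y)) : ℝ :=
  qCondMutualInfo (cqState (fun y x => reducedAl (Ψ x y)) (fun y x => h x y) fun y x => μ.1 (x, y))

/-- The supremum of the information divulged at one point of time, over both players and all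
distributions on the inputs. -/
def qDivulged {a b : ℕ} (Ψ : X → Y → QState a b) (h : X → Y → W) : EReal :=
  ⨆ μ : stdSimplex ℝ (X × Y), max (qDivulgedToBob Ψ h μ : EReal) (qDivulgedToAl Ψ h μ : EReal)

/-- The supremum of the divulged information over the present time and the times after each of the
remaining rounds, when the present state on inputs `x, y` is `Ψ x y`. -/
def QuantumRounds.lossFrom (h : X → Y → W) :
    {a b : ℕ} → QuantumRounds X Y W a b → (X → Y → QState a b) → EReal
  | _, _, .output _ _, Ψ => qDivulged Ψ h
  | _, _, .al U e next, Ψ =>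
      max (qDivulged Ψ h) (next.lossFrom h fun x y => sendAl e (applyAl (U x) (Ψ x y)))
  | _, _, .bob U e next, Ψ =>
      max (qDivulged Ψ h) (next.lossFrom h fun x y => sendBob e (applyBob (U y) (Ψ x y)))

/-- A quantum protocol: Al starts with `a` and Bob with `b` private qubits in state `|0⟩`. -/
structure QuantumProtocol (X : Type u) (Y : Type v) (W : Type w) where
  a : ℕ
  b : ℕ
  rounds : QuantumRounds X Y W a b

/-- The protocol computes `h` with error `ε`: on every input, both players output the right value
with probability at least `1 - ε`. -/
def QuantumProtocol.Computes (P : QuantumProtocol X Y W) (ε : ℝ) (h : X → Y → W) : Prop :=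
  ∀ x y, 1 - ε ≤ P.rounds.successProb x y (h x y) (initialState P.a P.b)

/-- The privacy loss of a quantum protocol for `h`: the supremum of the divulged information over
all times, both players, and all distributions on the inputs. -/
def QuantumProtocol.privacyLoss (P : QuantumProtocol X Y W) (h : X → Y → W) : EReal :=
  P.rounds.lossFrom h fun _ _ => initialState P.a P.b

end Quantum

/-! ## Private computation and the hint sense of privacy loss -/

section Hint

variable {X : Type u} {Y : Type v} [Fintype X] [Fintype Y] [DecidableEq X] [DecidableEq Y]

/-- Some deterministic protocol computes `h` (without error) and has privacy loss `0`. -/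
def DeterministicallyPrivate {W : Type} [DecidableEq W] (h : X → Y → W) : Prop :=
  ∃ P : ClassicalProtocol X Y W, P.IsDeterministic ∧ P.Computes 0 h ∧ P.privacyLoss h = 0

/-- Some classical randomized protocol computes `h` with error `ε` and has privacy loss `0`. -/
def ClassicallyPrivate (ε : ℝ) {W : Type} [DecidableEq W] (h : X → Y → W) : Prop :=
  ∃ P : ClassicalProtocol X Y W, P.Computes ε h ∧ P.privacyLoss h = 0

/-- Some quantum protocol computes `h` with error `ε` and has privacy loss `0`. -/
def QuantumPrivate (ε : ℝ) {W : Type} [Fintype W] [DecidableEq W] (h : X → Y → W) : Prop :=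
  ∃ P : QuantumProtocol X Y W, P.Computes ε h ∧ P.privacyLoss h = 0

/-- `f` can be computed with privacy loss `k` in the hint sense, with respect to a notion `Priv` of
privately computable functions: `f(x,y)` is a function of `h(x,y)` for some privately computable
`h`, and `k` is the difference of the logarithms of the sizes of the ranges of `h` and `f`. -/
def HintComputable {Z : Type*}
    (Priv : ∀ (W : Type) [Fintype W] [DecidableEq W], (X → Y → W) → Prop)
    (f : X → Y → Z) (k : ℝ) : Prop :=
  ∃ (W : Type) (_ : Fintype W) (_ : DecidableEq W) (h : X → Y → W),
    Priv W h ∧ (∃ g : W → Z, ∀ x y, f x y = g (h x y)) ∧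
    k = Real.logb 2 (Set.range fun p : X × Y => h p.1 p.2).ncard
      - Real.logb 2 (Set.range fun p : X × Y => f p.1 p.2).ncard

/-- The privacy loss of `f` in the hint sense: the infimum of all `k` such that `f` can be computed
with privacy loss `k` in the hint sense. -/
def hintPrivacyLoss {Z : Type*}
    (Priv : ∀ (W : Type) [Fintype W] [DecidableEq W], (X → Y → W) → Prop)
    (f : X → Y → Z) : EReal :=
  ⨅ (k : ℝ) (_ : HintComputable Priv f k), (k : EReal)

/-- Hint-sense privacy loss when deterministic protocols are allowed. -/
def deterministicHintLoss {Z : Type*} (f : X → Y → Z) : EReal :=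
  hintPrivacyLoss (fun _ _ _ h => DeterministicallyPrivate h) f

/-- Hint-sense privacy loss when classical randomized protocols with error `ε` are allowed. -/
def classicalHintLoss {Z : Type*} (ε : ℝ) (f : X → Y → Z) : EReal :=
  hintPrivacyLoss (fun _ _ _ h => ClassicallyPrivate ε h) f

/-- Hint-sense privacy loss when quantum protocols with error `ε` are allowed. -/
def quantumHintLoss {Z : Type*} (ε : ℝ) (f : X → Y → Z) : EReal :=
  hintPrivacyLoss (fun _ _ _ h => QuantumPrivate ε h) f

end Hint

end TwoParty

end


/-!
The three kinds of private computation coincide with a combinatorial property of `h`: every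
rectangle on which `h` is not constant splits into two rectangles, along the rows or along the
columns, such that no value of `h` occurs in the same column, respectively row, of both parts.

If `h` is decomposable, the players announce in turn in which part their inputs lie. What one of
them learns in this way is a function of his own input and of the value of `h`, so the protocol is
deterministic and loses nothing; run reversibly on computational basis states it is a quantum
protocol, in which each player's qubits at all times encode just the current rectangle.

Conversely, suppose that nothing is divulged. Vanishing conditional mutual information means that
the state of Bob is the same for all inputs of Al that lead to the same value in Bob's column, and
vice versa; this is the equality case of the superadditivity of the unnormalized entropy
`S(A) - η(tr A)`. Suppose inductively that on an indecomposable rectangle the joint state has not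
depended on the inputs, up to local unitaries. When Al applies a unitary and sends qubits, the new
state is the old one up to a unitary on what Al keeps, since inputs in the same column with the same
value of `h` leave Bob with the same reduced state, and by indecomposability such coincidences
connect all the rows of the rectangle. So the state never depends on the inputs in the rectangle,
and `h`, computed with error less than `1 / 2`, is constant there. For classical protocols the same
induction runs on the distribution of the coins conditioned on the transcript.
-/

noncomputable section

namespace TwoParty

section Subadditivity

open InformationTheory Real

variable {ι κ : Type*} [Fintype ι] [Fintype κ] {s : ι → κ → ℝ}

/-- The product of the marginals of a nonnegative weight `s`, with the same total weight as `s`. If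
`s` vanishes identically, so does this one, by division by zero. -/
def marginalProduct (s : ι → κ → ℝ) (i : ι) (k : κ) : ℝ :=
  (∑ k', s i k') * (∑ i', s i' k) / ∑ i', ∑ k', s i' k'

theorem marginalProduct_nonneg (hs : ∀ i k, 0 ≤ s i k) (i : ι) (k : κ) :
    0 ≤ marginalProduct s i k :=
  div_nonneg
    (mul_nonneg (Finset.sum_nonneg fun _ _ => hs _ _) (Finset.sum_nonneg fun _ _ => hs _ _))
    (Finset.sum_nonneg fun _ _ => Finset.sum_nonneg fun _ _ => hs _ _)

theorem sum_marginalProduct (s : ι → κ → ℝ) :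
    ∑ i, ∑ k, marginalProduct s i k = ∑ i, ∑ k, s i k := by
  simp only [marginalProduct, ← Finset.sum_div, ← Finset.mul_sum, ← Finset.sum_mul]
  rw [Finset.sum_comm (f := fun k i => s i k), mul_self_div_self]

theorem marginals_pos (hs : ∀ i k, 0 ≤ s i k) {i : ι} {k : κ} (hik : s i k ≠ 0) :
    0 < ∑ k', s i k' ∧ 0 < ∑ i', s i' k ∧ 0 < ∑ i', ∑ k', s i' k' := by
  have pos : 0 < s i k := (hs i k).lt_of_ne' hik
  have row : 0 < ∑ k', s i k' :=
    pos.trans_le (Finset.single_le_sum (fun k' _ => hs i k') (Finset.mem_univ k))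
  refine ⟨row, pos.trans_le (Finset.single_le_sum (f := fun i' => s i' k) (fun i' _ => hs i' k)
    (Finset.mem_univ i)), row.trans_le ?_⟩
  exact Finset.single_le_sum (f := fun i' => ∑ k', s i' k')
    (fun _ _ => Finset.sum_nonneg fun _ _ => hs _ _) (Finset.mem_univ i)

theorem mul_klFun_div {a q : ℝ} (h : a ≠ 0 → q ≠ 0) :
    q * klFun (a / q) = q - a - a * log q - negMulLog a := by
  by_cases ha : a = 0
  · simp [ha, klFun]
  · have hq := h ha
    rw [klFun_apply, log_div ha hq, negMulLog]
    field_simp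
    ring

theorem mul_log_marginalProduct (hs : ∀ i k, 0 ≤ s i k) (i : ι) (k : κ) :
    s i k * log (marginalProduct s i k) = s i k * log (∑ k', s i k') +
      s i k * log (∑ i', s i' k) - s i k * log (∑ i', ∑ k', s i' k') := by
  by_cases hik : s i k = 0
  · simp [hik]
  · obtain ⟨row, col, total⟩ := marginals_pos hs hik
    rw [marginalProduct, log_div (mul_pos row col).ne' total.ne', log_mul row.ne' col.ne']
    ring

theorem sum_marginalProduct_mul_klFun (hs : ∀ i k, 0 ≤ s i k) :
    ∑ i, ∑ k, marginalProduct s i k * klFun (s i k / marginalProduct s i k) =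
      ∑ i, negMulLog (∑ k, s i k) + ∑ k, negMulLog (∑ i, s i k) -
        negMulLog (∑ i, ∑ k, s i k) - ∑ i, ∑ k, negMulLog (s i k) := by
  have expand (i k) : marginalProduct s i k * klFun (s i k / marginalProduct s i k) =
      marginalProduct s i k - s i k - (s i k * log (∑ k', s i k') + s i k * log (∑ i', s i' k) -
        s i k * log (∑ i', ∑ k', s i' k')) - negMulLog (s i k) := by
    rw [← mul_log_marginalProduct hs, mul_klFun_div]
    intro hik
    obtain ⟨row, col, total⟩ := marginals_pos hs hik
    exact (div_pos (mul_pos row col) total).ne'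
  simp only [expand, Finset.sum_sub_distrib, Finset.sum_add_distrib, sum_marginalProduct]
  rw [Finset.sum_comm (f := fun i k => s i k * log (∑ i', s i' k))]
  simp only [← Finset.sum_mul, negMulLog, neg_mul, Finset.sum_neg_distrib]
  ring

theorem sum_negMulLog_add_negMulLog_sum_le (hs : ∀ i k, 0 ≤ s i k) :
    ∑ i, ∑ k, negMulLog (s i k) + negMulLog (∑ i, ∑ k, s i k) ≤
      ∑ i, negMulLog (∑ k, s i k) + ∑ k, negMulLog (∑ i, s i k) := by
  have nonneg := Finset.sum_nonneg fun i (_ : i ∈ Finset.univ) => Finset.sum_nonneg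
    fun k (_ : k ∈ Finset.univ) => mul_nonneg (marginalProduct_nonneg hs i k)
      (klFun_nonneg (div_nonneg (hs i k) (marginalProduct_nonneg hs i k)))
  rw [sum_marginalProduct_mul_klFun hs] at nonneg
  linarith

theorem mul_sum_eq_of_sum_negMulLog_eq (hs : ∀ i k, 0 ≤ s i k)
    (heq : ∑ i, ∑ k, negMulLog (s i k) + negMulLog (∑ i, ∑ k, s i k) =
      ∑ i, negMulLog (∑ k, s i k) + ∑ k, negMulLog (∑ i, s i k)) (i : ι) (k : κ) :
    s i k * ∑ i', ∑ k', s i' k' = (∑ k', s i k') * ∑ i', s i' k := by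
  have term_nonneg (i k) :
      0 ≤ marginalProduct s i k * klFun (s i k / marginalProduct s i k) :=
    mul_nonneg (marginalProduct_nonneg hs i k)
      (klFun_nonneg (div_nonneg (hs i k) (marginalProduct_nonneg hs i k)))
  have sum_eq : ∑ i, ∑ k, marginalProduct s i k * klFun (s i k / marginalProduct s i k) = 0 := by
    rw [sum_marginalProduct_mul_klFun hs]
    linarith
  rw [Finset.sum_eq_zero_iff_of_nonneg fun i _ => Finset.sum_nonneg fun k _ => term_nonneg i k]
    at sum_eq
  have term_eq := (Finset.sum_eq_zero_iff_of_nonneg fun k _ => term_nonneg i k).1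
    (sum_eq i (Finset.mem_univ i)) k (Finset.mem_univ k)
  by_cases total : ∑ i', ∑ k', s i' k' = 0
  · have row : ∑ k', s i k' = 0 := (Finset.sum_eq_zero_iff_of_nonneg fun i' _ =>
      Finset.sum_nonneg fun k' _ => hs i' k').1 total i (Finset.mem_univ i)
    rw [total, row, mul_zero, zero_mul]
  have hmul : marginalProduct s i k * ∑ i', ∑ k', s i' k' = (∑ k', s i k') * ∑ i', s i' k :=
    div_mul_cancel₀ _ total
  rcases mul_eq_zero.1 term_eq with hq | hkl
  · by_contra hne
    rw [← hmul, hq, zero_mul, mul_eq_zero, or_iff_left total] at hne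
    obtain ⟨row, col, -⟩ := marginals_pos hs hne
    exact (mul_pos row col).ne' (by rw [← hmul, hq, zero_mul])
  · rw [klFun_eq_zero_iff (div_nonneg (hs i k) (marginalProduct_nonneg hs i k))] at hkl
    rw [← hmul, eq_of_div_eq_one hkl]

end Subadditivity

section Peierls

variable {𝕜 E ι κ : Type*} [RCLike 𝕜] [NormedAddCommGroup E] [InnerProductSpace 𝕜 E] [Fintype ι]
  [Fintype κ] {T : E →ₗ[𝕜] E} {f : OrthonormalBasis κ 𝕜 E} {l : κ → ℝ}

theorem map_eq_sum_smul_of_eigenbasis (hT : ∀ j, T (f j) = (l j : 𝕜) • f j) (v : E) :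
    T v = ∑ j, (l j * inner 𝕜 (f j) v : 𝕜) • f j := by
  conv_lhs => rw [← f.sum_repr' v, map_sum]
  exact Finset.sum_congr rfl fun j _ => by rw [map_smul, hT, smul_smul, mul_comm]

theorem re_inner_map_self_eq_sum (hT : ∀ j, T (f j) = (l j : 𝕜) • f j) (v : E) :
    RCLike.re (inner 𝕜 v (T v)) = ∑ j, ‖inner 𝕜 (f j) v‖ ^ 2 * l j := by
  rw [map_eq_sum_smul_of_eigenbasis hT, inner_sum, map_sum]
  refine Finset.sum_congr rfl fun j _ => ?_
  rw [inner_smul_right, mul_assoc, ← inner_conj_symm v (f j), RCLike.mul_conj, mul_comm]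
  norm_cast

theorem sum_sum_sq_norm_inner_mul (e : OrthonormalBasis ι 𝕜 E)
    (f : OrthonormalBasis κ 𝕜 E) (c : κ → ℝ) :
    ∑ i, ∑ j, ‖inner 𝕜 (f j) (e i)‖ ^ 2 * c j = ∑ j, c j := by
  rw [Finset.sum_comm]
  simp only [← Finset.sum_mul, e.sum_sq_norm_inner_left, f.norm_eq_one, one_pow, one_mul]

variable {s : Set ℝ} {φ : ℝ → ℝ} (e : OrthonormalBasis ι 𝕜 E)

theorem sum_sq_norm_inner_mul_map_le (hφ : ConcaveOn ℝ s φ) (hl : ∀ j, l j ∈ s)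
    (hT : ∀ j, T (f j) = (l j : 𝕜) • f j) (i : ι) :
    ∑ j, ‖inner 𝕜 (f j) (e i)‖ ^ 2 * φ (l j) ≤ φ (RCLike.re (inner 𝕜 (e i) (T (e i)))) := by
  rw [re_inner_map_self_eq_sum hT]
  exact hφ.le_map_sum (fun _ _ => by positivity) (by simp [f.sum_sq_norm_inner_right])
    fun j _ => hl j

theorem sum_map_eigenvalue_le (hφ : ConcaveOn ℝ s φ) (hl : ∀ j, l j ∈ s)
    (hT : ∀ j, T (f j) = (l j : 𝕜) • f j) :
    ∑ j, φ (l j) ≤ ∑ i, φ (RCLike.re (inner 𝕜 (e i) (T (e i)))) := by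
  rw [← sum_sum_sq_norm_inner_mul e f]
  exact Finset.sum_le_sum fun i _ => sum_sq_norm_inner_mul_map_le e hφ hl hT i

theorem map_eq_smul_of_sum_map_eigenvalue_eq (hφ : StrictConcaveOn ℝ s φ) (hl : ∀ j, l j ∈ s)
    (hT : ∀ j, T (f j) = (l j : 𝕜) • f j)
    (heq : ∑ j, φ (l j) = ∑ i, φ (RCLike.re (inner 𝕜 (e i) (T (e i))))) (i : ι) :
    T (e i) = ((RCLike.re (inner 𝕜 (e i) (T (e i))) : ℝ) : 𝕜) • e i := by
  rw [← sum_sum_sq_norm_inner_mul e f, Finset.sum_eq_sum_iff_of_le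
    fun i _ => sum_sq_norm_inner_mul_map_le e hφ.concaveOn hl hT i] at heq
  have jensen_eq := (heq i (Finset.mem_univ i)).symm
  rw [re_inner_map_self_eq_sum hT] at jensen_eq
  have eigenvalue_eq := (hφ.map_sum_eq_iff' (fun _ _ => by positivity)
    (by simp [f.sum_sq_norm_inner_right]) fun j _ => hl j).1 jensen_eq
  simp only [smul_eq_mul, ← re_inner_map_self_eq_sum hT] at eigenvalue_eq
  generalize RCLike.re (inner 𝕜 (e i) (T (e i))) = r at eigenvalue_eq ⊢
  conv_rhs => rw [← f.sum_repr' (e i), Finset.smul_sum]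
  rw [map_eq_sum_smul_of_eigenbasis hT]
  refine Finset.sum_congr rfl fun j _ => ?_
  by_cases hj : inner 𝕜 (f j) (e i) = 0
  · simp [hj]
  · rw [smul_smul, eigenvalue_eq j (Finset.mem_univ j) (by simpa using hj)]

end Peierls

section VonNeumann

open scoped ComplexOrder
open Real

variable {S T : Type*} [Fintype S] [DecidableEq S] [Fintype T] [DecidableEq T]

theorem vonNeumannEntropy_eq_sum_eigenvalues {A : Matrix S S ℂ} (hA : A.IsHermitian) :
    vonNeumannEntropy A = (∑ i, negMulLog (hA.eigenvalues i)) / log 2 := by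
  rw [vonNeumannEntropy, hA.roots_charpoly_eq_eigenvalues, Finset.sum_div, Multiset.map_map]
  rfl

theorem toEuclideanLin_eigenvectorBasis {A : Matrix S S ℂ} (hA : A.IsHermitian) (j : S) :
    A.toEuclideanLin (hA.eigenvectorBasis j) =
      (hA.eigenvalues j : ℂ) • hA.eigenvectorBasis j := by
  ext k
  simpa [Matrix.toEuclideanLin] using congrFun (hA.mulVec_eigenvectorBasis j) k

/-- The diagonal of `A` in the orthonormal basis `e`: the distribution of the outcome when a state
`A` is measured in this basis. -/
def diagIn (e : OrthonormalBasis S ℂ (EuclideanSpace ℂ S)) (A : Matrix S S ℂ) (k : S) : ℝ :=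
  (inner ℂ (e k) (A.toEuclideanLin (e k))).re

variable (e : OrthonormalBasis S ℂ (EuclideanSpace ℂ S)) {A : Matrix S S ℂ}

theorem diagIn_nonneg (hA : A.PosSemidef) (k : S) : 0 ≤ diagIn e A k := by
  have h := (Complex.nonneg_iff.1 ((Matrix.posSemidef_iff_dotProduct_mulVec.1 hA).2 (e k).ofLp)).1
  rwa [dotProduct_comm] at h

theorem diagIn_eigenvectorBasis (hA : A.IsHermitian) (k : S) :
    diagIn hA.eigenvectorBasis A k = hA.eigenvalues k := by
  rw [diagIn, toEuclideanLin_eigenvectorBasis, inner_smul_right, inner_self_eq_norm_sq_to_K,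
    OrthonormalBasis.norm_eq_one]
  simp

theorem diagIn_sum {ι : Type*} [Fintype ι] (P : ι → Matrix S S ℂ) (k : S) :
    diagIn e (∑ i, P i) k = ∑ i, diagIn e (P i) k := by
  simp only [diagIn, map_sum, LinearMap.sum_apply, inner_sum, Complex.re_sum]

theorem sum_diagIn (A : Matrix S S ℂ) : ∑ k, diagIn e A k = A.trace.re := by
  rw [← A.trace_toLin_eq (EuclideanSpace.basisFun S ℂ).toBasis,
    ← Matrix.toEuclideanLin_eq_toLin_orthonormal, LinearMap.trace_eq_sum_inner _ e, Complex.re_sum]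
  rfl

theorem vonNeumannEntropy_le_sum_negMulLog_diagIn (hA : A.PosSemidef) :
    vonNeumannEntropy A ≤ (∑ k, negMulLog (diagIn e A k)) / log 2 := by
  rw [vonNeumannEntropy_eq_sum_eigenvalues hA.1]
  exact div_le_div_of_nonneg_right (sum_map_eigenvalue_le e concaveOn_negMulLog
    hA.eigenvalues_nonneg (toEuclideanLin_eigenvectorBasis hA.1)) (log_nonneg one_le_two)

theorem toEuclideanLin_eq_of_vonNeumannEntropy_eq (hA : A.PosSemidef)
    (heq : vonNeumannEntropy A = (∑ k, negMulLog (diagIn e A k)) / log 2) (k : S) :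
    A.toEuclideanLin (e k) = (diagIn e A k : ℂ) • e k := by
  rw [vonNeumannEntropy_eq_sum_eigenvalues hA.1, div_left_inj' (log_pos one_lt_two).ne'] at heq
  exact map_eq_smul_of_sum_map_eigenvalue_eq e strictConcaveOn_negMulLog
    hA.eigenvalues_nonneg (toEuclideanLin_eigenvectorBasis hA.1) heq k

/-- The trace of `A` times the entropy (in bits) of the state `A / tr A`. -/
def weightedEntropy (A : Matrix S S ℂ) : ℝ :=
  vonNeumannEntropy A - negMulLog A.trace.re / log 2

section Superadditivity

variable {ι : Type*} [Fintype ι] {P : ι → Matrix S S ℂ}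

/-- The outcome of the measurement of the states `P i` in an eigenbasis of their sum. -/
def jointDiag (hP : ∀ i, (P i).PosSemidef) (i : ι) (k : S) : ℝ :=
  diagIn (Matrix.posSemidef_sum Finset.univ fun i _ => hP i).1.eigenvectorBasis (P i) k

theorem jointDiag_nonneg (hP : ∀ i, (P i).PosSemidef) (i : ι) (k : S) : 0 ≤ jointDiag hP i k :=
  diagIn_nonneg _ (hP i) k

theorem weightedEntropy_le_jointDiag (hP : ∀ i, (P i).PosSemidef) (i : ι) :
    weightedEntropy (P i) ≤
      (∑ k, negMulLog (jointDiag hP i k) - negMulLog (∑ k, jointDiag hP i k)) / log 2 := by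
  simp only [jointDiag, sum_diagIn, sub_div]
  exact sub_le_sub_right (vonNeumannEntropy_le_sum_negMulLog_diagIn _ (hP i)) _

theorem weightedEntropy_sum (hP : ∀ i, (P i).PosSemidef) :
    weightedEntropy (∑ i, P i) = (∑ k, negMulLog (∑ i, jointDiag hP i k) -
      negMulLog (∑ i, ∑ k, jointDiag hP i k)) / log 2 := by
  have hsum := (Matrix.posSemidef_sum Finset.univ fun i _ => hP i).1
  rw [weightedEntropy, vonNeumannEntropy_eq_sum_eigenvalues hsum, sub_div, Finset.sum_comm,
    ← sum_diagIn hsum.eigenvectorBasis]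
  simp only [← diagIn_eigenvectorBasis hsum, diagIn_sum]
  rfl

theorem sum_jointDiag_le_weightedEntropy_sum (hP : ∀ i, (P i).PosSemidef) :
    ∑ i, (∑ k, negMulLog (jointDiag hP i k) - negMulLog (∑ k, jointDiag hP i k)) / log 2 ≤
      weightedEntropy (∑ i, P i) := by
  rw [weightedEntropy_sum hP, ← Finset.sum_div, Finset.sum_sub_distrib]
  have := sum_negMulLog_add_negMulLog_sum_le (jointDiag_nonneg hP)
  exact div_le_div_of_nonneg_right (by linarith) (log_nonneg one_le_two)

theorem sum_weightedEntropy_le (hP : ∀ i, (P i).PosSemidef) :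
    ∑ i, weightedEntropy (P i) ≤ weightedEntropy (∑ i, P i) :=
  (Finset.sum_le_sum fun i _ => weightedEntropy_le_jointDiag hP i).trans
    (sum_jointDiag_le_weightedEntropy_sum hP)

theorem trace_smul_eq_of_weightedEntropy_sum_le (hP : ∀ i, (P i).PosSemidef)
    (hle : weightedEntropy (∑ i, P i) ≤ ∑ i, weightedEntropy (P i)) (i : ι) :
    (∑ j, P j).trace.re • P i = (P i).trace.re • ∑ j, P j := by
  have hsum := (Matrix.posSemidef_sum Finset.univ fun i _ => hP i).1
  have measured_le := Finset.sum_le_sum fun i (_ : i ∈ Finset.univ) =>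
    weightedEntropy_le_jointDiag hP i
  have eigen (j k) : (P j).toEuclideanLin (hsum.eigenvectorBasis k) =
      (jointDiag hP j k : ℂ) • hsum.eigenvectorBasis k := by
    refine toEuclideanLin_eq_of_vonNeumannEntropy_eq _ (hP j) ?_ k
    have := (Finset.sum_eq_sum_iff_of_le fun i _ => weightedEntropy_le_jointDiag hP i).1
      (measured_le.antisymm ((sum_jointDiag_le_weightedEntropy_sum hP).trans hle)) j
      (Finset.mem_univ j)
    simpa only [weightedEntropy, jointDiag, sum_diagIn, sub_div, sub_left_inj] using this
  have product (k) := mul_sum_eq_of_sum_negMulLog_eq (jointDiag_nonneg hP) (by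
    have := (sum_jointDiag_le_weightedEntropy_sum hP).antisymm (hle.trans measured_le)
    rw [weightedEntropy_sum hP, ← Finset.sum_div, Finset.sum_sub_distrib,
      div_left_inj' (log_pos one_lt_two).ne'] at this
    linarith) i k
  have marginal (j) : ∑ k, jointDiag hP j k = (P j).trace.re := sum_diagIn _ _
  apply (Matrix.toEuclideanLin (𝕜 := ℂ) (m := S) (n := S)).injective
  refine hsum.eigenvectorBasis.toBasis.ext fun k => ?_
  simp only [marginal] at product
  rw [← Complex.coe_smul, ← Complex.coe_smul, map_smul, map_smul, map_sum, LinearMap.smul_apply,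
    LinearMap.smul_apply, LinearMap.sum_apply, OrthonormalBasis.coe_toBasis]
  simp only [eigen, smul_smul, ← Finset.sum_smul]
  rw [Matrix.trace_sum, Complex.re_sum, mul_comm]
  exact_mod_cast congrArg (fun r : ℝ => (r : ℂ) • hsum.eigenvectorBasis k) (product k)

end Superadditivity

theorem charpoly_blockDiagonal {R : Type*} [CommRing R] (M : T → Matrix S S R) :
    (Matrix.blockDiagonal M).charpoly = ∏ k, (M k).charpoly := by
  have charmatrix : (Matrix.blockDiagonal M).charmatrix =
      Matrix.blockDiagonal fun k => (M k).charmatrix := by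
    ext ⟨i, k⟩ ⟨j, l⟩
    by_cases hkl : k = l
    · subst hkl
      simp [Matrix.charmatrix, Matrix.blockDiagonal_apply, Matrix.diagonal_apply]
    · simp [Matrix.charmatrix, Matrix.blockDiagonal_apply, hkl]
  simp only [Matrix.charpoly, charmatrix, Matrix.det_blockDiagonal]

theorem vonNeumannEntropy_blockDiagonal (M : T → Matrix S S ℂ) :
    vonNeumannEntropy (Matrix.blockDiagonal M) = ∑ k, vonNeumannEntropy (M k) := by
  rw [vonNeumannEntropy, charpoly_blockDiagonal, Polynomial.roots_prod _ _
    (Finset.prod_ne_zero_iff.2 fun k _ => (Matrix.charpoly_monic _).ne_zero), Multiset.map_bind,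
    Multiset.sum_bind]
  rfl

theorem vonNeumannEntropy_diagonal (d : S → ℂ) :
    vonNeumannEntropy (Matrix.diagonal d) = (∑ i, negMulLog (d i).re) / log 2 := by
  rw [vonNeumannEntropy, Matrix.charpoly_diagonal, Polynomial.roots_prod _ _
    (Finset.prod_ne_zero_iff.2 fun k _ => Polynomial.X_sub_C_ne_zero _), Multiset.map_bind,
    Multiset.sum_bind, Finset.sum_div]
  simp

theorem weightedEntropy_zero : weightedEntropy (0 : Matrix S S ℂ) = 0 := by
  rw [weightedEntropy, ← Matrix.diagonal_zero, vonNeumannEntropy_diagonal]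
  simp

theorem weightedEntropy_smul_diagonal (c : ℝ) (d : S → ℝ) :
    weightedEntropy (c • Matrix.diagonal fun i => (d i : ℂ)) =
      c * weightedEntropy (Matrix.diagonal fun i => (d i : ℂ)) := by
  have scale (a : ℝ) : negMulLog (c * a) = a * negMulLog c + c * negMulLog a := negMulLog_mul c a
  rw [weightedEntropy, weightedEntropy, ← Matrix.diagonal_smul, vonNeumannEntropy_diagonal,
    vonNeumannEntropy_diagonal]
  simp [scale, Finset.sum_add_distrib, ← Finset.mul_sum, ← Finset.sum_mul, Matrix.trace]
  ring

theorem qCondMutualInfo_blockDiagonal {Q R : Type*} [Fintype Q] [Fintype R] [DecidableEq Q]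
    [DecidableEq R] (M : Q × R → Matrix S S ℂ) :
    qCondMutualInfo (Matrix.blockDiagonal M) =
      ∑ r, (weightedEntropy (∑ q, M (q, r)) - ∑ q, weightedEntropy (M (q, r))) := by
  have mid : traceMid (Matrix.blockDiagonal M) = Matrix.blockDiagonal fun r => ∑ q, M (q, r) := by
    ext ⟨s, r⟩ ⟨s', r'⟩
    by_cases hr : r = r' <;> simp [traceMid, Matrix.blockDiagonal_apply, hr, Matrix.sum_apply]
  have fst : traceFst (Matrix.blockDiagonal M) = Matrix.diagonal fun i => (M i).trace := by
    ext i j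
    by_cases hij : i = j
    · simp [traceFst, Matrix.blockDiagonal_apply, hij, Matrix.trace]
    · simp [traceFst, Matrix.blockDiagonal_apply, hij]
  have fst_fst : traceFst (traceFst (Matrix.blockDiagonal M)) =
      Matrix.diagonal fun r => (∑ q, M (q, r)).trace := by
    rw [fst]
    ext r r'
    by_cases hr : r = r' <;> simp [traceFst, hr, Matrix.trace_sum]
  rw [qCondMutualInfo, fst_fst, mid, fst, vonNeumannEntropy_blockDiagonal,
    vonNeumannEntropy_blockDiagonal, vonNeumannEntropy_diagonal, vonNeumannEntropy_diagonal]
  simp only [weightedEntropy, Finset.sum_sub_distrib, Fintype.sum_prod_type_right, Finset.sum_div]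
  ring

end VonNeumann

section ClassicalQuantum

open scoped ComplexOrder

variable {X Y W B : Type*} [DecidableEq X] [DecidableEq Y] [DecidableEq W]

/-- The blocks of the block diagonal matrix `cqState σ h μ`. -/
def cqBlock (σ : X → Y → Matrix B B ℂ) (h : X → Y → W) (μ : X → Y → ℝ) (i : X × Y × W) :
    Matrix B B ℂ :=
  if i.2.2 = h i.1 i.2.1 then μ i.1 i.2.1 • σ i.1 i.2.1 else 0

theorem cqState_eq_blockDiagonal (σ : X → Y → Matrix B B ℂ) (h : X → Y → W) (μ : X → Y → ℝ) :
    cqState σ h μ = Matrix.blockDiagonal (cqBlock σ h μ) := by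
  ext ⟨b, i⟩ ⟨b', j⟩
  simp only [cqState, cqBlock, Matrix.blockDiagonal_apply, ite_and]
  split_ifs <;> simp

variable [Fintype X] [Fintype Y] [Fintype W] [Fintype B] [DecidableEq B]
  {σ : X → Y → Matrix B B ℂ} {h : X → Y → W} {μ : X → Y → ℝ}

theorem qCondMutualInfo_cqState (σ : X → Y → Matrix B B ℂ) (h : X → Y → W) (μ : X → Y → ℝ) :
    qCondMutualInfo (cqState σ h μ) =
      ∑ r, (weightedEntropy (∑ x, cqBlock σ h μ (x, r)) -
        ∑ x, weightedEntropy (cqBlock σ h μ (x, r))) := by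
  rw [cqState_eq_blockDiagonal, qCondMutualInfo_blockDiagonal]

theorem eq_of_qCondMutualInfo_cqState_nonpos (hpos : ∀ x y, (σ x y).PosSemidef)
    (htrace : ∀ x y, (σ x y).trace = 1) (hμ : ∀ x y, 0 < μ x y)
    (hI : qCondMutualInfo (cqState σ h μ) ≤ 0) {x x' : X} {y : Y} (hh : h x y = h x' y) :
    σ x y = σ x' y := by
  have block_pos (i) : (cqBlock σ h μ i).PosSemidef := by
    unfold cqBlock
    split_ifs
    · exact (hpos _ _).smul (hμ _ _).le
    · exact .zero
  have superadditive (r) := sub_nonneg.2 (sum_weightedEntropy_le fun x => block_pos (x, r))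
  rw [qCondMutualInfo_cqState] at hI
  have additive := (Finset.sum_eq_zero_iff_of_nonneg fun r _ => superadditive r).1
    (hI.antisymm (Finset.sum_nonneg fun r _ => superadditive r)) (y, h x y) (Finset.mem_univ _)
  have proportional (x₁) (hx₁ : h x y = h x₁ y) :
      (∑ j, cqBlock σ h μ (j, y, h x y)).trace.re • σ x₁ y =
        ∑ j, cqBlock σ h μ (j, y, h x y) := by
    have := trace_smul_eq_of_weightedEntropy_sum_le (fun j => block_pos (j, y, h x y))
      (sub_nonpos.1 additive.le) x₁
    rw [cqBlock, if_pos hx₁, Matrix.trace_smul, htrace, smul_comm] at this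
    simpa [(hμ x₁ y).ne'] using this
  refine smul_right_injective _ ?_ ((proportional x rfl).trans (proportional x' hh).symm)
  rw [Matrix.trace_sum, Complex.re_sum]
  refine (Finset.sum_pos' (fun j _ => ?_) ⟨x, Finset.mem_univ x, ?_⟩).ne'
  · exact (Complex.nonneg_iff.1 (block_pos _).trace_nonneg).1
  · simp [cqBlock, htrace, hμ x y]

theorem qCondMutualInfo_cqState_diagonal_eq_zero {d : X → Y → B → ℝ}
    (hd : ∀ x x' y, h x y = h x' y → d x y = d x' y) (μ : X → Y → ℝ) :
    qCondMutualInfo (cqState (fun x y => Matrix.diagonal fun b => (d x y b : ℂ)) h μ) = 0 := by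
  rw [qCondMutualInfo_cqState]
  refine Finset.sum_eq_zero fun ⟨y, w⟩ _ => sub_eq_zero.2 ?_
  by_cases hw : ∃ x₀, w = h x₀ y
  · obtain ⟨x₀, rfl⟩ := hw
    have block (x) : cqBlock (fun x y => Matrix.diagonal fun b => (d x y b : ℂ)) h μ
        (x, y, h x₀ y) =
        (if h x₀ y = h x y then μ x y else 0) • Matrix.diagonal fun b => (d x₀ y b : ℂ) := by
      by_cases hx : h x₀ y = h x y
      · simp [cqBlock, hx, hd x₀ x y hx]
      · simp [cqBlock, hx]
    simp only [block, ← Finset.sum_smul, weightedEntropy_smul_diagonal, ← Finset.sum_mul]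
  · push Not at hw
    simp [cqBlock, hw, weightedEntropy_zero]

end ClassicalQuantum

section ClassicalInformation

open Real
open scoped ComplexOrder

variable {Ω P Q R : Type*} [Fintype Ω] [DecidableEq P] [DecidableEq Q] [DecidableEq R]

/-- The distribution of the random variable `g` on the finite probability space `Ω` with weights
`p`. -/
def law (p : Ω → ℝ) (g : Ω → P) (v : P) : ℝ :=
  ∑ ω with g ω = v, p ω

theorem shannonEntropy_eq_vonNeumannEntropy [Fintype P] (p : Ω → ℝ) (g : Ω → P) :
    shannonEntropy p g = vonNeumannEntropy (Matrix.diagonal fun v => (law p g v : ℂ)) := by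
  rw [shannonEntropy, vonNeumannEntropy_diagonal, Finset.sum_div]
  refine Finset.sum_subset (Finset.subset_univ _) fun v _ hv => ?_
  rw [Finset.sum_eq_zero, negMulLog_zero, zero_div]
  intro ω hω
  exact absurd (Finset.mem_image_of_mem g (Finset.mem_univ ω)) ((Finset.mem_filter.1 hω).2 ▸ hv)

theorem sum_law_fst [Fintype P] (p : Ω → ℝ) (V : Ω → P) (U : Ω → Q) (u : Q) :
    ∑ v, law p (fun ω => (V ω, U ω)) (v, u) = law p U u := by
  simp only [law, Finset.sum_filter, Prod.mk.injEq, ite_and]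
  rw [Finset.sum_comm]
  simp

theorem sum_law_mid [Fintype Q] (p : Ω → ℝ) (V : Ω → P) (U : Ω → Q) (Z : Ω → R) (i : P × R) :
    ∑ u, law p (fun ω => (V ω, U ω, Z ω)) (i.1, u, i.2) = law p (fun ω => (V ω, Z ω)) i := by
  rw [← sum_law_fst p U]
  refine Finset.sum_congr rfl fun u _ => Finset.sum_congr (Finset.filter_congr fun ω _ => ?_)
    fun _ _ => rfl
  simp only [Prod.ext_iff]
  tauto

theorem condMutualInfo_eq_qCondMutualInfo [Fintype P] [Fintype Q] [Fintype R] (p : Ω → ℝ)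
    (V : Ω → P) (U : Ω → Q) (Z : Ω → R) :
    condMutualInfo p V U Z = qCondMutualInfo
      (Matrix.diagonal fun i => (law p (fun ω => (V ω, U ω, Z ω)) i : ℂ)) := by
  have fst : traceFst (Matrix.diagonal fun i => (law p (fun ω => (V ω, U ω, Z ω)) i : ℂ)) =
      Matrix.diagonal fun i => (law p (fun ω => (U ω, Z ω)) i : ℂ) := by
    ext i j
    obtain rfl | hij := eq_or_ne i j
    · rw [Matrix.diagonal_apply_eq, ← sum_law_fst p V]
      simp [traceFst]
    · simp [traceFst, hij]
  have fst_fst : traceFst (Matrix.diagonal fun i => (law p (fun ω => (U ω, Z ω)) i : ℂ)) =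
      Matrix.diagonal fun z => (law p Z z : ℂ) := by
    ext i j
    obtain rfl | hij := eq_or_ne i j
    · rw [Matrix.diagonal_apply_eq, ← sum_law_fst p U]
      simp [traceFst]
    · simp [traceFst, hij]
  have mid : traceMid (Matrix.diagonal fun i => (law p (fun ω => (V ω, U ω, Z ω)) i : ℂ)) =
      Matrix.diagonal fun i => (law p (fun ω => (V ω, Z ω)) i : ℂ) := by
    ext i j
    obtain rfl | hij := eq_or_ne i j
    · rw [Matrix.diagonal_apply_eq, ← sum_law_mid p V U Z]
      simp [traceMid]
    · simp [traceMid, hij, ← Prod.ext_iff]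
  simp only [condMutualInfo, qCondMutualInfo, shannonEntropy_eq_vonNeumannEntropy, fst, fst_fst,
    mid]

theorem shannonEntropy_comp_injective {e : P → Q} (he : e.Injective) (p : Ω → ℝ) (g : Ω → P) :
    shannonEntropy p (e ∘ g) = shannonEntropy p g := by
  rw [shannonEntropy, shannonEntropy, ← Finset.image_image, Finset.sum_image he.injOn]
  simp only [Function.comp_apply, he.eq_iff]

theorem condMutualInfo_comp_injective {P' : Type*} [DecidableEq P'] {e : P → P'}
    (he : e.Injective) (p : Ω → ℝ) (V : Ω → P) (U : Ω → Q) (Z : Ω → R) :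
    condMutualInfo p (e ∘ V) U Z = condMutualInfo p V U Z := by
  have pair := shannonEntropy_comp_injective (he.prodMap Function.injective_id) p
    fun ω => (V ω, Z ω)
  have triple := shannonEntropy_comp_injective (he.prodMap Function.injective_id) p
    fun ω => (V ω, U ω, Z ω)
  exact congrArg₂ (fun a b => a + _ - _ - b) pair triple

theorem shannonEntropy_comp_equiv {Ω' : Type*} [Fintype Ω'] (e : Ω' ≃ Ω) (p : Ω → ℝ) (g : Ω → P) :
    shannonEntropy (p ∘ e) (g ∘ e) = shannonEntropy p g := by
  have himage : Finset.univ.image (g ∘ e) = Finset.univ.image g := by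
    ext v
    simp [e.surjective.exists]
  simp only [shannonEntropy, himage, Finset.sum_filter, Function.comp_apply]
  exact Finset.sum_congr rfl fun v _ => by
    rw [e.sum_comp fun ω => if g ω = v then p ω else 0]

theorem condMutualInfo_comp_equiv {Ω' : Type*} [Fintype Ω'] (e : Ω' ≃ Ω) (p : Ω → ℝ)
    (V : Ω → P) (U : Ω → Q) (Z : Ω → R) :
    condMutualInfo (p ∘ e) (V ∘ e) (U ∘ e) (Z ∘ e) = condMutualInfo p V U Z := by
  simp only [condMutualInfo, ← shannonEntropy_comp_equiv e p]
  rfl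

variable {X Y W C : Type*} [Fintype X] [Fintype Y] [Fintype C] [DecidableEq X] [DecidableEq Y]
  [DecidableEq W]

/-- The information `I(V : X | Y, h(X,Y))` that `V` divulges about `X`, where the inputs have the
distribution `μ` and `V` depends on them and on independent randomness with distribution `ν`. -/
def divulged (μ : X → Y → ℝ) (ν : C → ℝ) (V : X → Y → C → P) (h : X → Y → W) : ℝ :=
  condMutualInfo (fun ω : X × Y × C => μ ω.1 ω.2.1 * ν ω.2.2) (fun ω => V ω.1 ω.2.1 ω.2.2)
    (fun ω => ω.1) (fun ω => (ω.2.1, h ω.1 ω.2.1))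

theorem law_inputs_eq (μ : X → Y → ℝ) (ν : C → ℝ) (V : X → Y → C → P) (h : X → Y → W) (v : P)
    (i : X × Y × W) :
    law (fun ω : X × Y × C => μ ω.1 ω.2.1 * ν ω.2.2)
      (fun ω => (V ω.1 ω.2.1 ω.2.2, ω.1, ω.2.1, h ω.1 ω.2.1)) (v, i) =
      if i.2.2 = h i.1 i.2.1 then μ i.1 i.2.1 * law ν (V i.1 i.2.1) v else 0 := by
  obtain ⟨x, y, w⟩ := i
  simp only [law, Finset.sum_filter, Fintype.sum_prod_type, Prod.mk.injEq]
  rw [Fintype.sum_eq_single x, Fintype.sum_eq_single y]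
  · split_ifs with hw
    · simp [hw, Finset.mul_sum]
    · simp [Ne.symm hw]
  · exact fun y' hy => by simp [hy]
  · exact fun x' hx => by simp [hx]

theorem divulged_eq_qCondMutualInfo_cqState [Fintype P] [Fintype W] (μ : X → Y → ℝ) (ν : C → ℝ)
    (V : X → Y → C → P) (h : X → Y → W) :
    divulged μ ν V h = qCondMutualInfo
      (cqState (fun x y => Matrix.diagonal fun v => (law ν (V x y) v : ℂ)) h μ) := by
  rw [divulged, condMutualInfo_eq_qCondMutualInfo]
  congr 1
  ext ⟨v, i⟩ ⟨v', i'⟩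
  simp only [cqState, Matrix.diagonal_apply, law_inputs_eq, Prod.mk.injEq, ite_and]
  split_ifs <;> simp

theorem divulged_comp_injective {P' : Type*} [DecidableEq P'] {e : P → P'} (he : e.Injective)
    (μ : X → Y → ℝ) (ν : C → ℝ) (V : X → Y → C → P) (h : X → Y → W) :
    divulged μ ν (fun x y => e ∘ V x y) h = divulged μ ν V h :=
  condMutualInfo_comp_injective he _ (fun ω : X × Y × C => V ω.1 ω.2.1 ω.2.2) _ _

theorem law_comp_injective {e : P → Q} (he : e.Injective) (p : Ω → ℝ) (g : Ω → P) (v : P) :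
    law p (e ∘ g) (e v) = law p g v := by
  simp only [law, Function.comp_apply, he.eq_iff]

theorem law_comp_congr {p : Ω → ℝ} {g g' : Ω → P} (hg : law p g = law p g') (e : P → Q) :
    law p (e ∘ g) = law p (e ∘ g') := by
  let s := Finset.univ.image g ∪ Finset.univ.image g'
  have fiberwise {k : Ω → P} (hk : ∀ ω, k ω ∈ s) (v : Q) :
      law p (e ∘ k) v = ∑ u ∈ s with e u = v, law p k u := by
    simp only [law, Function.comp_apply]
    rw [← Finset.sum_fiberwise_of_maps_to (g := k) (t := {u ∈ s | e u = v}) (by simp [hk])]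
    refine Finset.sum_congr rfl fun u hu => ?_
    rw [Finset.filter_filter, ← (Finset.mem_filter.1 hu).2]
    exact Finset.sum_congr (Finset.filter_congr fun ω _ => by grind) fun _ _ => rfl
  funext v
  rw [fiberwise (by simp [s]), fiberwise (by simp [s]), hg]

variable [Finite W] {ν : C → ℝ} {V : X → Y → C → P} {h : X → Y → W}

theorem divulged_eq_zero (hV : ∀ x x' y, h x y = h x' y → law ν (V x y) = law ν (V x' y))
    (μ : X → Y → ℝ) : divulged μ ν V h = 0 := by
  cases nonempty_fintype W
  let V' (x y c) : Set.range (fun ω : X × Y × C => V ω.1 ω.2.1 ω.2.2) := ⟨V x y c, (x, y, c), rfl⟩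
  refine (divulged_comp_injective Subtype.val_injective μ ν V' h).trans ?_
  rw [divulged_eq_qCondMutualInfo_cqState]
  refine qCondMutualInfo_cqState_diagonal_eq_zero (fun x x' y hh => funext fun v => ?_) μ
  rw [← law_comp_injective Subtype.val_injective, ← law_comp_injective Subtype.val_injective]
  exact congrFun (hV x x' y hh) v.1

theorem law_eq_of_divulged_nonpos {μ : X → Y → ℝ} (hμ : ∀ x y, 0 < μ x y) (hν : ∀ c, 0 ≤ ν c)
    (hν_sum : ∑ c, ν c = 1) (hI : divulged μ ν V h ≤ 0) {x x' : X} {y : Y} (hh : h x y = h x' y) :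
    law ν (V x y) = law ν (V x' y) := by
  cases nonempty_fintype W
  let V' (x y c) : Set.range (fun ω : X × Y × C => V ω.1 ω.2.1 ω.2.2) := ⟨V x y c, (x, y, c), rfl⟩
  have hI' := (divulged_comp_injective Subtype.val_injective μ ν V' h).symm.trans_le hI
  rw [divulged_eq_qCondMutualInfo_cqState] at hI'
  have diagonal_pos (x y) : (Matrix.diagonal fun v => (law ν (V' x y) v : ℂ)).PosSemidef := by
    refine Matrix.PosSemidef.diagonal fun v => Complex.zero_le_real.2 ?_
    exact Finset.sum_nonneg fun c _ => hν c
  have trace_diagonal (x y) : (Matrix.diagonal fun v => (law ν (V' x y) v : ℂ)).trace = 1 := by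
    rw [Matrix.trace_diagonal, ← Complex.ofReal_sum, ← Complex.ofReal_one, ← hν_sum]
    simp only [law, Finset.sum_fiberwise]
  have diagonal_eq := eq_of_qCondMutualInfo_cqState_nonpos diagonal_pos trace_diagonal hμ hI' hh
  have law_eq : law ν (V' x y) = law ν (V' x' y) :=
    funext fun v => Complex.ofReal_injective (congrFun (Matrix.diagonal_injective diagonal_eq) v)
  exact law_comp_congr law_eq Subtype.val

end ClassicalInformation

section Decomposition

variable {X Y W : Type*}

/-- The bit `c x` may be announced on the rectangle `S × T`: it is determined by `(y, h x y)`. -/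
def RowSplit (h : X → Y → W) (S : Set X) (T : Set Y) (c : X → Bool) : Prop :=
  ∀ x₁ ∈ S, ∀ x₂ ∈ S, ∀ y ∈ T, h x₁ y = h x₂ y → c x₁ = c x₂

/-- All rows of `S × T` are equivalent under the equivalence relation generated by `h x₁ y = h x₂ y`
for some `y ∈ T`. This is encoded by the equivalent condition that every row split is constant. -/
def RowConnected (h : X → Y → W) (S : Set X) (T : Set Y) : Prop :=
  ∀ c : X → Bool, RowSplit h S T c → ∀ x₁ ∈ S, ∀ x₂ ∈ S, c x₁ = c x₂

/-- `h` is constant on the rectangle `S × T`. -/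
def ConstantOnRectangle (h : X → Y → W) (S : Set X) (T : Set Y) : Prop :=
  ∀ x₁ ∈ S, ∀ y₁ ∈ T, ∀ x₂ ∈ S, ∀ y₂ ∈ T, h x₁ y₁ = h x₂ y₂

/-- No rectangle is forbidden, in the sense that all its rows are equivalent and all its columns are
equivalent although `h` is not constant on it. This is the combinatorial characterization of the
privately computable functions. -/
def NoForbiddenRectangle (h : X → Y → W) : Prop :=
  ∀ (S : Set X) (T : Set Y), RowConnected h S T → RowConnected (fun y x => h x y) T S →
    ConstantOnRectangle h S T

/-- The rectangle `S × T` can be cut into rectangles on which `h` is constant by `n` rounds of a row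
split followed by column splits. -/
def Decomposable (h : X → Y → W) : ℕ → Set X → Set Y → Prop
  | 0, S, T => ConstantOnRectangle h S T
  | n + 1, S, T => ∃ c, RowSplit h S T c ∧ ∀ b, ∃ d,
      RowSplit (fun y x => h x y) T {x ∈ S | c x = b} d ∧
        ∀ b', Decomposable h n {x ∈ S | c x = b} {y ∈ T | d y = b'}

variable {h : X → Y → W} {S S' : Set X} {T T' : Set Y}

theorem RowConnected.apply_eq (hS : RowConnected h S T) {α : Type*} (F : X → α)
    (hF : ∀ x ∈ S, ∀ x' ∈ S, ∀ y ∈ T, h x y = h x' y → F x = F x') {x x' : X} (hx : x ∈ S)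
    (hx' : x' ∈ S) : F x = F x' := by
  classical
  have hsplit : RowSplit h S T fun z => decide (F z = F x') := fun z hz z' hz' y hy hzz' => by
    simp only [hF z hz z' hz' y hy hzz']
  simpa using hS _ hsplit x hx x' hx'

theorem RowSplit.mono {c : X → Bool} (hc : RowSplit h S T c) (hS : S' ⊆ S) (hT : T' ⊆ T) :
    RowSplit h S' T' c :=
  fun x hx x' hx' y hy => hc x (hS hx) x' (hS hx') y (hT hy)

theorem rowSplit_const (h : X → Y → W) (S : Set X) (T : Set Y) (b : Bool) :
    RowSplit h S T fun _ => b :=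
  fun _ _ _ _ _ _ _ => rfl

theorem Decomposable.mono {n : ℕ} (hD : Decomposable h n S T) (hS : S' ⊆ S) (hT : T' ⊆ T) :
    Decomposable h n S' T' := by
  induction n generalizing S S' T T' with
  | zero => exact fun x hx y hy x' hx' y' hy' => hD x (hS hx) y (hT hy) x' (hS hx') y' (hT hy')
  | succ n ih =>
    obtain ⟨c, hc, hD⟩ := hD
    refine ⟨c, hc.mono hS hT, fun b => ?_⟩
    obtain ⟨d, hd, hD⟩ := hD b
    have hS' : {x ∈ S' | c x = b} ⊆ {x ∈ S | c x = b} := fun x hx => ⟨hS hx.1, hx.2⟩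
    exact ⟨d, hd.mono hT hS', fun b' => ih (hD b') hS' fun y hy => ⟨hT hy.1, hy.2⟩⟩

theorem Decomposable.succ {n : ℕ} (hD : Decomposable h n S T) : Decomposable h (n + 1) S T :=
  ⟨_, rowSplit_const h S T true, fun _ => ⟨_, rowSplit_const _ _ _ true, fun _ =>
    hD.mono (fun _ hx => hx.1) fun _ hy => hy.1⟩⟩

theorem Decomposable.of_le {n m : ℕ} (hD : Decomposable h n S T) (hnm : n ≤ m) :
    Decomposable h m S T := by
  induction hnm with
  | refl => exact hD
  | step _ ih => exact ih.succ

theorem RowSplit.exists_decomposable {c : X → Bool} (hc : RowSplit h S T c)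
    (hD : ∀ b, ∃ n, Decomposable h n {x ∈ S | c x = b} T) : ∃ n, Decomposable h n S T := by
  choose n hn using hD
  refine ⟨max (n false) (n true) + 1, c, hc, fun b => ⟨_, rowSplit_const _ _ _ true, fun b' => ?_⟩⟩
  refine ((hn b).of_le ?_).mono subset_rfl fun y hy => hy.1
  cases b <;> simp

theorem RowSplit.exists_decomposable_of_column {d : Y → Bool}
    (hd : RowSplit (fun y x => h x y) T S d)
    (hD : ∀ b, ∃ n, Decomposable h n S {y ∈ T | d y = b}) : ∃ n, Decomposable h n S T := by
  choose n hn using hD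
  refine ⟨max (n false) (n true) + 1, _, rowSplit_const h S T true, fun b =>
    ⟨d, hd.mono subset_rfl fun x hx => hx.1, fun b' => ?_⟩⟩
  refine ((hn b').of_le ?_).mono (fun x hx => hx.1) subset_rfl
  cases b' <;> simp

theorem ncard_setOf_apply_eq_lt {α β : Type*} [Finite α] {S : Set α} {c : α → β} {x x' : α}
    (hx : x ∈ S) (hx' : x' ∈ S) (hne : c x ≠ c x') (b : β) :
    {x ∈ S | c x = b}.ncard < S.ncard := by
  refine Set.ncard_lt_ncard ⟨fun x hx => hx.1, fun hsub => hne ?_⟩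
  rw [(hsub hx).2, (hsub hx').2]

theorem NoForbiddenRectangle.exists_decomposable [Finite X] [Finite Y]
    (hh : NoForbiddenRectangle h) (S : Set X) (T : Set Y) : ∃ n, Decomposable h n S T := by
  induction hk : S.ncard + T.ncard using Nat.strong_induction_on generalizing S T with
  | _ k ih =>
    subst hk
    by_cases hrow : RowConnected h S T
    · by_cases hcol : RowConnected (fun y x => h x y) T S
      · exact ⟨0, hh S T hrow hcol⟩
      · simp only [RowConnected, not_forall] at hcol
        obtain ⟨d, hd, y, hy, y', hy', hne⟩ := hcol
        exact hd.exists_decomposable_of_column fun b =>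
          ih _ (Nat.add_lt_add_left (ncard_setOf_apply_eq_lt hy hy' hne b) _) _ _ rfl
    · simp only [RowConnected, not_forall] at hrow
      obtain ⟨c, hc, x, hx, x', hx', hne⟩ := hrow
      exact hc.exists_decomposable fun b =>
        ih _ (Nat.add_lt_add_right (ncard_setOf_apply_eq_lt hx hx' hne b) _) _ _ rfl

end Decomposition

section QuantumLowerBound

open scoped ComplexOrder

theorem range_mulVecLin_mul_conjTranspose {I B : Type*} [Fintype I] [Fintype B]
    (M : Matrix I B ℂ) : (M * Mᴴ).mulVecLin.range = M.mulVecLin.range := by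
  refine Submodule.eq_of_le_of_finrank_eq ?_ M.rank_self_mul_conjTranspose
  rw [Matrix.mulVecLin_mul]
  exact LinearMap.range_comp_le_range _ _

theorem exists_eq_mul_of_mul_conjTranspose_eq {I B : Type*} [Finite I] [Fintype B]
    {M N : Matrix I B ℂ} (h : M * Mᴴ = N * Nᴴ) : ∃ V : Matrix B B ℂ, M = N * V := by
  classical
  cases nonempty_fintype I
  have range_eq : M.mulVecLin.range = N.mulVecLin.range := by
    rw [← range_mulVecLin_mul_conjTranspose, h, range_mulVecLin_mul_conjTranspose]
  have col_mem (b) : M.col b ∈ N.mulVecLin.range :=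
    range_eq ▸ ⟨Pi.single b 1, M.mulVec_single_one b⟩
  choose V hV using col_mem
  exact ⟨.of fun b' b => V b b', Matrix.ext fun i b => (congrFun (hV b) i).symm⟩

section Aligned

variable {X Y W A B : Type*} [Fintype B] {Ψ : X → Y → Matrix A B ℂ} {S : Set X} {T : Set Y}

/-- The Gram matrices `Ψ x y * (Ψ x' y)ᴴ` of the rows in `S` do not depend on the column `y` in `T`.
Equivalently, a change of the column acts on the states of all rows by one and the same operator on
the second register. -/
def Aligned (Ψ : X → Y → Matrix A B ℂ) (S : Set X) (T : Set Y) : Prop :=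
  ∀ x ∈ S, ∀ x' ∈ S, ∀ y ∈ T, ∀ y' ∈ T, Ψ x y * (Ψ x' y)ᴴ = Ψ x y' * (Ψ x' y')ᴴ

theorem Aligned.exists_eq_mul [Finite X] [Finite A] (hΨ : Aligned Ψ S T) {y y' : Y} (hy : y ∈ T)
    (hy' : y' ∈ T) : ∃ V : Matrix B B ℂ, ∀ x ∈ S, Ψ x y' = Ψ x y * V := by
  classical
  cases nonempty_fintype X
  cases nonempty_fintype A
  let stack (y : Y) : Matrix (S × A) B ℂ := .of fun i b => Ψ i.1 y i.2 b
  have gram_eq : stack y' * (stack y')ᴴ = stack y * (stack y)ᴴ := by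
    ext i j
    exact congrFun₂ (hΨ i.1 i.1.2 j.1 j.1.2 y' hy' y hy) i.2 j.2
  obtain ⟨V, hV⟩ := exists_eq_mul_of_mul_conjTranspose_eq gram_eq
  exact ⟨V, fun x hx => Matrix.ext fun a b => congrFun₂ hV (⟨x, hx⟩, a) b⟩

theorem Aligned.transpose [Finite X] [Fintype A] (hΨ : Aligned Ψ S T) {h : X → Y → W}
    (hS : RowConnected h S T)
    (hred : ∀ x x' y, h x y = h x' y → (Ψ x y)ᵀ * (Ψ x y)ᵀᴴ = (Ψ x' y)ᵀ * (Ψ x' y)ᵀᴴ) :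
    Aligned (fun y x => (Ψ x y)ᵀ) T S := by
  intro y hy y' hy' x hx x' hx'
  refine hS.apply_eq (fun x => (Ψ x y)ᵀ * (Ψ x y')ᵀᴴ) (fun x hx x' hx' y₀ hy₀ hxx' => ?_) hx hx'
  obtain ⟨V, hV⟩ := hΨ.exists_eq_mul hy₀ hy
  obtain ⟨V', hV'⟩ := hΨ.exists_eq_mul hy₀ hy'
  have conj (x) (hx : x ∈ S) :
      (Ψ x y)ᵀ * (Ψ x y')ᵀᴴ = Vᵀ * ((Ψ x y₀)ᵀ * (Ψ x y₀)ᵀᴴ) * V'ᵀᴴ := by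
    simp only [hV x hx, hV' x hx, Matrix.transpose_mul, Matrix.conjTranspose_mul, Matrix.mul_assoc]
  change (Ψ x y)ᵀ * (Ψ x y')ᵀᴴ = (Ψ x' y)ᵀ * (Ψ x' y')ᵀᴴ
  rw [conj x hx, conj x' hx', hred x x' y₀ hxx']

end Aligned

section Rounds

variable {a b m k : ℕ}

/-- The computational basis state `|α⟩|β⟩`. -/
def basisState (α : Fin a → Bool) (β : Fin b → Bool) : QState a b :=
  fun α' β' => if α' = α ∧ β' = β then 1 else 0

theorem reducedAl_basisState (α : Fin a → Bool) (β : Fin b → Bool) :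
    reducedAl (basisState α β) =
      Matrix.diagonal fun α' => ((Pi.single α 1 : (Fin a → Bool) → ℝ) α' : ℂ) := by
  ext α₁ α₂
  simp only [reducedAl, basisState, Matrix.diagonal_apply, Pi.single_apply, ite_and]
  by_cases h₁ : α₁ = α <;> by_cases h₂ : α₂ = α <;> simp_all [eq_comm]

theorem trace_reducedAl_initialState (a b : ℕ) : (reducedAl (initialState a b)).trace = 1 := by
  rw [show initialState a b = basisState _ _ from rfl, reducedAl_basisState,
    Matrix.trace_diagonal, ← Complex.ofReal_sum, Finset.sum_pi_single']
  simp

theorem applyAl_eq_mul (U : QUnitary a) (ψ : QState a b) :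
    Matrix.of (applyAl U ψ) = U.1 * Matrix.of ψ :=
  rfl

theorem reducedAl_eq_mul (ψ : QState a b) : reducedAl ψ = Matrix.of ψ * (Matrix.of ψ)ᴴ :=
  rfl

/-- The basis states of a register of qubits, in terms of those of the two parts into which it is
split by `e`. -/
def splitEquiv (e : Fin a ≃ Fin m ⊕ Fin k) :
    (Fin m → Bool) × (Fin k → Bool) ≃ (Fin a → Bool) :=
  (Equiv.sumArrowEquivProdArrow _ _ _).symm.trans (e.arrowCongr (Equiv.refl Bool)).symm

theorem sendAl_append (e : Fin a ≃ Fin m ⊕ Fin k) (ψ : QState a b) (γ : Fin m → Bool)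
    (α : Fin k → Bool) (β : Fin b → Bool) :
    sendAl e ψ α (Fin.append γ β) = ψ (splitEquiv e (γ, α)) β := by
  simp only [sendAl, Fin.append_left, Fin.append_right]
  rfl

theorem sendAl_mul_conjTranspose (e : Fin a ≃ Fin m ⊕ Fin k) (ψ φ : QState a b) :
    Matrix.of (sendAl e ψ) * (Matrix.of (sendAl e φ))ᴴ = Matrix.of fun α α' =>
      ∑ γ, (Matrix.of ψ * (Matrix.of φ)ᴴ) (splitEquiv e (γ, α)) (splitEquiv e (γ, α')) := by
  ext α α'
  simp only [Matrix.mul_apply, Matrix.conjTranspose_apply, Matrix.of_apply]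
  rw [← (Fin.appendEquiv m b).sum_comp, Fintype.sum_prod_type]
  simp only [Fin.appendEquiv, Equiv.coe_fn_mk, sendAl_append]

theorem Aligned.sendAl_applyAl {X Y : Type*} {Ψ : X → Y → QState a b} {S : Set X} {T : Set Y}
    (hΨ : Aligned (fun x y => Matrix.of (Ψ x y)) S T) (U : X → QUnitary a)
    (e : Fin a ≃ Fin m ⊕ Fin k) :
    Aligned (fun x y => Matrix.of (sendAl e (applyAl (U x) (Ψ x y)))) S T := by
  intro x hx x' hx' y hy y' hy'
  have hU (y) : Matrix.of (applyAl (U x) (Ψ x y)) * (Matrix.of (applyAl (U x') (Ψ x' y)))ᴴ =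
      (U x).1 * (Matrix.of (Ψ x y) * (Matrix.of (Ψ x' y))ᴴ) * (U x').1ᴴ := by
    simp only [applyAl_eq_mul, Matrix.conjTranspose_mul, Matrix.mul_assoc]
  have gram_eq := hΨ x hx x' hx' y hy y' hy'
  simp only [sendAl_mul_conjTranspose, hU] at gram_eq ⊢
  rw [gram_eq]

theorem trace_reducedAl_applyAl (U : QUnitary a) (ψ : QState a b) :
    (reducedAl (applyAl U ψ)).trace = (reducedAl ψ).trace := by
  rw [reducedAl_eq_mul, reducedAl_eq_mul, applyAl_eq_mul, Matrix.conjTranspose_mul,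
    Matrix.mul_assoc, Matrix.trace_mul_comm, Matrix.mul_assoc, Matrix.mul_assoc,
    ← Matrix.star_eq_conjTranspose U.1, Matrix.UnitaryGroup.star_mul_self, Matrix.mul_one]

theorem trace_reducedAl_sendAl (e : Fin a ≃ Fin m ⊕ Fin k) (ψ : QState a b) :
    (reducedAl (sendAl e ψ)).trace = (reducedAl ψ).trace := by
  rw [reducedAl_eq_mul, sendAl_mul_conjTranspose, Matrix.trace, Matrix.trace,
    ← (splitEquiv e).sum_comp, Fintype.sum_prod_type_right]
  rfl

theorem trace_reducedBob (ψ : QState a b) : (reducedBob ψ).trace = (reducedAl ψ).trace :=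
  Finset.sum_comm

theorem trace_reducedAl_sendBob_applyBob (e : Fin b ≃ Fin m ⊕ Fin k) (U : QUnitary b)
    (ψ : QState a b) :
    (reducedAl (sendBob e (applyBob U ψ))).trace = (reducedAl ψ).trace := by
  calc (reducedAl (sendBob e (applyBob U ψ))).trace
      = (reducedBob (sendBob e (applyBob U ψ))).trace := (trace_reducedBob _).symm
    _ = (reducedAl (applyAl U fun β α => ψ α β)).trace :=
        trace_reducedAl_sendAl e (applyAl U fun β α => ψ α β)
    _ = (reducedBob ψ).trace := trace_reducedAl_applyAl U fun β α => ψ α β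
    _ = (reducedAl ψ).trace := trace_reducedBob ψ

end Rounds

section ProbableOutputs

theorem eq_of_half_lt {A V : Type*} [Fintype A] [DecidableEq V] {p : A → ℝ} (hp : ∀ a, 0 ≤ p a)
    (hsum : ∑ a, p a = 1) (out : A → V) {z z' : V}
    (hz : 1 / 2 < ∑ a with out a = z, p a) (hz' : 1 / 2 < ∑ a with out a = z', p a) : z = z' := by
  by_contra hne
  have hdisjoint : Disjoint (Finset.univ.filter (out · = z)) (Finset.univ.filter (out · = z')) :=
    Finset.disjoint_filter.2 fun a _ ha ha' => hne (ha.symm.trans ha')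
  have hle := Finset.sum_le_univ_sum_of_nonneg (s := Finset.disjUnion _ _ hdisjoint) hp
  rw [Finset.sum_disjUnion] at hle
  linarith

theorem mul_conjTranspose_apply_self {A B : Type*} [Fintype B] (M : Matrix A B ℂ) (i : A) :
    (M * Mᴴ) i i = ((∑ j, ‖M i j‖ ^ 2 : ℝ) : ℂ) := by
  simp only [Matrix.mul_apply, Matrix.conjTranspose_apply]
  push_cast
  exact Finset.sum_congr rfl fun j _ => Complex.mul_conj' _

theorem eq_of_probable_outputs {A B V : Type*} [Fintype A] [Fintype B] [DecidableEq V]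
    {M N : Matrix A B ℂ} (hMN : M * Mᴴ = N * Nᴴ) (hM : (M * Mᴴ).trace = 1) (out : A → V)
    {z z' : V} (q q' : B → Prop) [DecidablePred q] [DecidablePred q']
    (hz : 1 / 2 < ∑ a, ∑ b, if out a = z ∧ q b then ‖M a b‖ ^ 2 else 0)
    (hz' : 1 / 2 < ∑ a, ∑ b, if out a = z' ∧ q' b then ‖N a b‖ ^ 2 else 0) : z = z' := by
  have row_norm_eq (i) : ∑ j, ‖M i j‖ ^ 2 = ∑ j, ‖N i j‖ ^ 2 := by
    have := congrFun₂ hMN i i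
    rw [mul_conjTranspose_apply_self, mul_conjTranspose_apply_self] at this
    exact_mod_cast this
  have forget_other (K : Matrix A B ℂ) (z : V) (q : B → Prop) [DecidablePred q] :
      (∑ a, ∑ b, if out a = z ∧ q b then ‖K a b‖ ^ 2 else 0) ≤
        ∑ a with out a = z, ∑ b, ‖K a b‖ ^ 2 := by
    rw [Finset.sum_filter]
    refine Finset.sum_le_sum fun a _ => ?_
    split_ifs with ha
    · exact Finset.sum_le_sum fun b _ => by split_ifs <;> simp
    · simp [ha]
  have total : ∑ a, ∑ b, ‖M a b‖ ^ 2 = 1 := by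
    simp only [Matrix.trace, Matrix.diag_apply, mul_conjTranspose_apply_self] at hM
    exact_mod_cast hM
  refine eq_of_half_lt (fun a => by positivity) total out (hz.trans_le (forget_other M z q)) ?_
  simp only [row_norm_eq]
  exact hz'.trans_le (forget_other N z' q')

theorem constantOnRectangle_of_outputs {X Y W : Type*} [DecidableEq W] {a b : ℕ}
    {Ψ : X → Y → QState a b} {h : X → Y → W} {S : Set X} {T : Set Y}
    (hnorm : ∀ x y, (reducedAl (Ψ x y)).trace = 1)
    (hA : Aligned (fun x y => Matrix.of (Ψ x y)) S T)
    (hB : Aligned (fun y x => (Matrix.of (Ψ x y))ᵀ) T S) {outA : X → (Fin a → Bool) → W}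
    {outB : Y → (Fin b → Bool) → W}
    (hout : ∀ x y, 1 / 2 < (QuantumRounds.output outA outB).successProb x y (h x y) (Ψ x y)) :
    ConstantOnRectangle h S T := by
  intro x hx y hy x' hx' y' hy'
  simp only [QuantumRounds.successProb] at hout
  have hout' (x y) : 1 / 2 <
      ∑ β, ∑ α, if outB y β = h x y ∧ outA x α = h x y then ‖Ψ x y α β‖ ^ 2 else 0 := by
    rw [Finset.sum_comm]
    simpa only [and_comm] using hout x y
  calc h x y = h x y' := eq_of_probable_outputs (hA x hx x hx y hy y' hy') (hnorm x y) (outA x)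
        (outB y · = h x y) (outB y' · = h x y') (hout x y) (hout x y')
    _ = h x' y' := eq_of_probable_outputs (hB y' hy' y' hy' x hx x' hx')
        ((trace_reducedBob _).trans (hnorm x y')) (outB y') (outA x · = h x y')
        (outA x' · = h x' y') (hout' x y') (hout' x' y')

end ProbableOutputs

section Privacy

theorem barycenter_pos {ι : Type*} [Fintype ι] [Nonempty ι] (i : ι) :
    0 < (stdSimplex.barycenter (𝕜 := ℝ) (X := ι)).1 i := by
  rw [stdSimplex.barycenter_apply]
  positivity

variable {X Y W : Type*} [Fintype X] [Fintype Y] [DecidableEq X] [DecidableEq Y]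
  [Fintype W] [DecidableEq W] {a b : ℕ} {Ψ : X → Y → QState a b} {h : X → Y → W}

theorem reducedBob_eq_of_qDivulged_nonpos (hnorm : ∀ x y, (reducedAl (Ψ x y)).trace = 1)
    (hloss : qDivulged Ψ h ≤ 0) {x x' : X} {y : Y} (hh : h x y = h x' y) :
    reducedBob (Ψ x y) = reducedBob (Ψ x' y) := by
  have : Nonempty X := ⟨x⟩
  have : Nonempty Y := ⟨y⟩
  refine eq_of_qCondMutualInfo_cqState_nonpos (σ := fun x y => reducedBob (Ψ x y))
    (fun x y => Matrix.posSemidef_self_mul_conjTranspose (Matrix.of (Ψ x y))ᵀ)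
    (fun x y => (trace_reducedBob _).trans (hnorm x y))
    (fun x y => barycenter_pos (x, y)) ?_ hh
  exact EReal.coe_nonpos.1 <|
    (le_max_left _ _).trans ((le_iSup _ stdSimplex.barycenter).trans hloss)

theorem reducedAl_eq_of_qDivulged_nonpos (hnorm : ∀ x y, (reducedAl (Ψ x y)).trace = 1)
    (hloss : qDivulged Ψ h ≤ 0) {x : X} {y y' : Y} (hh : h x y = h x y') :
    reducedAl (Ψ x y) = reducedAl (Ψ x y') := by
  have : Nonempty X := ⟨x⟩
  have : Nonempty Y := ⟨y⟩
  refine eq_of_qCondMutualInfo_cqState_nonpos (σ := fun y x => reducedAl (Ψ x y))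
    (h := fun y x => h x y)
    (fun y x => Matrix.posSemidef_self_mul_conjTranspose (Matrix.of (Ψ x y)))
    (fun y x => hnorm x y)
    (fun y x => barycenter_pos (x, y)) ?_ hh
  exact EReal.coe_nonpos.1 <|
    (le_max_right _ _).trans ((le_iSup _ stdSimplex.barycenter).trans hloss)

theorem qDivulged_le_lossFrom (R : QuantumRounds X Y W a b) (h : X → Y → W)
    (Ψ : X → Y → QState a b) : qDivulged Ψ h ≤ R.lossFrom h Ψ := by
  cases R with
  | output => exact le_rfl
  | al => exact le_max_left _ _
  | bob => exact le_max_left _ _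

variable {S : Set X} {T : Set Y}

theorem QuantumRounds.constantOnRectangle (hS : RowConnected h S T)
    (hT : RowConnected (fun y x => h x y) T S) (R : QuantumRounds X Y W a b)
    (hnorm : ∀ x y, (reducedAl (Ψ x y)).trace = 1) (hloss : R.lossFrom h Ψ ≤ 0)
    (hA : Aligned (fun x y => Matrix.of (Ψ x y)) S T)
    (hB : Aligned (fun y x => (Matrix.of (Ψ x y))ᵀ) T S)
    (hsucc : ∀ x y, 1 / 2 < R.successProb x y (h x y) (Ψ x y)) : ConstantOnRectangle h S T := by
  induction R with
  | output outA outB => exact constantOnRectangle_of_outputs hnorm hA hB hsucc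
  | al U e next ih =>
    have hnorm' (x y) : (reducedAl (sendAl e (applyAl (U x) (Ψ x y)))).trace = 1 :=
      (trace_reducedAl_sendAl e _).trans ((trace_reducedAl_applyAl (U x) _).trans (hnorm x y))
    have hloss' := (le_max_right _ _).trans hloss
    have hA' := hA.sendAl_applyAl U e
    refine ih hnorm' hloss' hA' (hA'.transpose hS fun _ _ _ => ?_) hsucc
    exact reducedBob_eq_of_qDivulged_nonpos hnorm' ((qDivulged_le_lossFrom next _ _).trans hloss')
  | bob U e next ih =>
    have hnorm' (x y) : (reducedAl (sendBob e (applyBob (U y) (Ψ x y)))).trace = 1 :=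
      (trace_reducedAl_sendBob_applyBob e (U y) _).trans (hnorm x y)
    have hloss' := (le_max_right _ _).trans hloss
    have hB' := Aligned.sendAl_applyAl (Ψ := fun y x β α => Ψ x y α β) hB U e
    refine ih hnorm' hloss' (hB'.transpose hT fun _ _ _ => ?_) hB' hsucc
    exact reducedAl_eq_of_qDivulged_nonpos hnorm' ((qDivulged_le_lossFrom next _ _).trans hloss')

theorem QuantumProtocol.noForbiddenRectangle {ε : ℝ} (hε : ε < 1 / 2) {P : QuantumProtocol X Y W}
    (hP : P.Computes ε h) (hloss : P.privacyLoss h = 0) : NoForbiddenRectangle h :=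
  fun _ _ hS hT => P.rounds.constantOnRectangle hS hT
    (fun _ _ => trace_reducedAl_initialState P.a P.b) hloss.le (fun _ _ _ _ _ _ _ _ => rfl)
    (fun _ _ _ _ _ _ _ _ => rfl) fun x y => by linarith [hP x y]

end Privacy

end QuantumLowerBound
section Knowledge

variable {X Y W L : Type*}

/-- The quantity `F x y` is known to Al as soon as he knows `x` and `h x y`. -/
def KnownToAl (h : X → Y → W) (F : X → Y → L) : Prop :=
  ∀ x y₁ y₂, h x y₁ = h x y₂ → F x y₁ = F x y₂

/-- The quantity `F x y` is known to Bob as soon as he knows `y` and `h x y`. -/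
def KnownToBob (h : X → Y → W) (F : X → Y → L) : Prop :=
  ∀ x₁ x₂ y, h x₁ y = h x₂ y → F x₁ y = F x₂ y

variable {h : X → Y → W}

theorem KnownToAl.map {L' : Type*} {F : X → Y → L} (hF : KnownToAl h F) (g : L → L') :
    KnownToAl h fun x y => g (F x y) :=
  fun x y y' hyy' => congrArg g (hF x y y' hyy')

theorem KnownToBob.map {L' : Type*} {F : X → Y → L} (hF : KnownToBob h F) (g : L → L') :
    KnownToBob h fun x y => g (F x y) :=
  fun x x' y hxx' => congrArg g (hF x x' y hxx')

theorem Decomposable.exists_announcements {m : ℕ} {k : X → Y → L}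
    (hD : ∀ l, Decomposable h (m + 1) {x | ∃ y, k x y = l} {y | ∃ x, k x y = l})
    (hAl : KnownToAl h k) (hBob : KnownToBob h k) :
    ∃ c d : X → Y → Bool, KnownToAl k c ∧ KnownToBob h c ∧
      KnownToBob (fun x y => (k x y, c x y)) d ∧ KnownToAl h d ∧
      ∀ l, Decomposable h m {x | ∃ y, (k x y, c x y, d x y) = l}
        {y | ∃ x, (k x y, c x y, d x y) = l} := by
  choose c hc d hd hD using hD
  refine ⟨fun x y => c (k x y) x, fun x y => d (k x y) (c (k x y) x) y,
    fun x _ _ hyy' => congrArg (c · x) hyy', fun x x' y hxx' => ?_, fun x x' y hxx' => ?_,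
    fun x y y' hyy' => ?_, fun ⟨l, b, b'⟩ => ?_⟩
  · have hk := hBob x x' y hxx'
    simpa only [hk] using hc (k x' y) x ⟨y, hk⟩ x' ⟨y, rfl⟩ y ⟨x, hk⟩ hxx'
  · obtain ⟨hk, hc⟩ := Prod.ext_iff.1 hxx'
    exact congrArg₂ (d · · y) hk hc
  · have hk := hAl x y y' hyy'
    simpa only [hk] using
      hd (k x y') (c (k x y') x) y ⟨x, hk⟩ y' ⟨x, rfl⟩ x ⟨⟨y', rfl⟩, rfl⟩ hyy'
  · refine (hD l b b').mono ?_ ?_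
    · rintro x ⟨y, hy⟩
      obtain ⟨rfl, rfl, -⟩ : k x y = l ∧ c (k x y) x = b ∧ _ := by simpa using hy
      exact ⟨⟨y, rfl⟩, rfl⟩
    · rintro y ⟨x, hx⟩
      obtain ⟨rfl, rfl, rfl⟩ : k x y = l ∧ c (k x y) x = b ∧ d (k x y) (c (k x y) x) y = b' := by
        simpa using hx
      exact ⟨⟨x, rfl⟩, rfl⟩

end Knowledge

section QuantumUpperBound

section BasisStates

variable {a b m k N : ℕ}

/-- The unitary operator permuting the computational basis. -/
def permUnitary (σ : Equiv.Perm (Fin a → Bool)) : QUnitary a :=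
  ⟨Matrix.of fun i j => if i = σ j then 1 else 0, by
    rw [Matrix.mem_unitaryGroup_iff]
    ext i j
    rw [Matrix.mul_apply, ← σ.symm.sum_comp]
    simp [Matrix.star_apply, Matrix.one_apply]⟩

theorem basisState_swap (α : Fin a → Bool) (β : Fin b → Bool) :
    (fun β' α' => basisState α β α' β') = basisState β α := by
  funext β' α'
  simp only [basisState, and_comm]

theorem reducedBob_basisState (α : Fin a → Bool) (β : Fin b → Bool) :
    reducedBob (basisState α β) =
      Matrix.diagonal fun β' => ((Pi.single β 1 : (Fin b → Bool) → ℝ) β' : ℂ) := by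
  rw [← reducedAl_basisState β α, ← basisState_swap]
  rfl

theorem applyAl_permUnitary (σ : Equiv.Perm (Fin a → Bool)) (α : Fin a → Bool)
    (β : Fin b → Bool) : applyAl (permUnitary σ) (basisState α β) = basisState (σ α) β := by
  funext α' β'
  simp only [applyAl, permUnitary, Matrix.of_apply, basisState]
  rw [Finset.sum_eq_single α] <;> simp +contextual [← ite_and, and_comm]

theorem applyBob_permUnitary (σ : Equiv.Perm (Fin b → Bool)) (α : Fin a → Bool)
    (β : Fin b → Bool) : applyBob (permUnitary σ) (basisState α β) = basisState α (σ β) := by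
  rw [← basisState_swap (σ β), ← applyAl_permUnitary, ← basisState_swap α]
  rfl

theorem sendAl_basisState (e : Fin a ≃ Fin m ⊕ Fin k) (γ : Fin m → Bool) (α : Fin k → Bool)
    (β : Fin b → Bool) :
    sendAl e (basisState (splitEquiv e (γ, α)) β) = basisState α (Fin.append γ β) := by
  funext α' δ
  obtain ⟨⟨γ', β'⟩, rfl⟩ := (Fin.appendEquiv m b).surjective δ
  have append_eq_iff : Fin.append γ' β' = Fin.append γ β ↔ γ' = γ ∧ β' = β :=
    (Fin.appendEquiv m b).injective.eq_iff.trans Prod.mk_inj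
  change sendAl e _ α' (Fin.append γ' β') = basisState α _ α' (Fin.append γ' β')
  simp only [sendAl_append, basisState, (splitEquiv e).injective.eq_iff, append_eq_iff,
    Prod.mk_inj]
  simp only [and_comm, and_assoc]

theorem sendBob_basisState (e : Fin b ≃ Fin m ⊕ Fin k) (α : Fin a → Bool) (γ : Fin m → Bool)
    (β : Fin k → Bool) :
    sendBob e (basisState α (splitEquiv e (γ, β))) = basisState (Fin.append γ α) β := by
  rw [← basisState_swap β, ← sendAl_basisState, ← basisState_swap α]
  rfl

theorem splitEquiv_finSumFinEquiv_symm (γ : Fin m → Bool) (α : Fin k → Bool) :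
    splitEquiv finSumFinEquiv.symm (γ, α) = Fin.append γ α := by
  funext i
  refine Fin.addCases (fun j => ?_) (fun j => ?_) i <;>
    simp [splitEquiv, Equiv.arrowCongr, Equiv.sumArrowEquivProdArrow]

theorem append_fin_zero (γ : Fin N → Bool) (α : Fin 0 → Bool) : Fin.append γ α = γ := by
  rw [Fin.append_right_nil _ _ rfl]
  rfl

theorem sendAl_sumEmpty_symm (γ : Fin N → Bool) (β : Fin b → Bool) :
    sendAl (Equiv.sumEmpty (Fin N) (Fin 0)).symm (basisState γ β) =
      basisState (fun j => j.elim0) (Fin.append γ β) :=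
  sendAl_basisState (Equiv.sumEmpty (Fin N) (Fin 0)).symm γ _ β

theorem sendBob_finSumFinEquiv_symm (α : Fin 0 → Bool) (γ : Fin N → Bool) (β : Fin b → Bool) :
    sendBob finSumFinEquiv.symm (basisState α (Fin.append γ β)) = basisState γ β := by
  rw [← splitEquiv_finSumFinEquiv_symm, sendBob_basisState, append_fin_zero]

theorem exists_perm_apply_eq {α β : Type*} [Finite β] {f g : α → β}
    (hfg : ∀ a a', f a = f a' ↔ g a = g a') : ∃ σ : Equiv.Perm β, ∀ a, σ (f a) = g a := by
  obtain ⟨σ, hσ⟩ := Equiv.Perm.exists_extending_pair (Subtype.val : Set.range f → β)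
    (fun b => g b.2.choose) Subtype.val_injective fun b b' hbb' => Subtype.ext <| by
      rw [← b.2.choose_spec, ← b'.2.choose_spec]
      exact (hfg _ _).2 hbb'
  exact ⟨σ, fun a => (hσ ⟨f a, a, rfl⟩).trans <|
    (hfg _ _).1 (Exists.choose_spec (⟨a, rfl⟩ : f a ∈ Set.range f))⟩

end BasisStates

section Rounds

variable {X Y W : Type*} [DecidableEq W] {h : X → Y → W} {a b N : ℕ}

theorem successProb_output_basisState (outA : X → (Fin a → Bool) → W)
    (outB : Y → (Fin b → Bool) → W) (x : X) (y : Y) (z : W) (α : Fin a → Bool)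
    (β : Fin b → Bool) :
    (QuantumRounds.output outA outB).successProb x y z (basisState α β) =
      if outA x α = z ∧ outB y β = z then 1 else 0 := by
  rw [QuantumRounds.successProb, Finset.sum_eq_single α, Finset.sum_eq_single β]
  all_goals simp +contextual [basisState]

variable [Fintype X] [Fintype Y] [Fintype W] [DecidableEq X] [DecidableEq Y]

theorem qDivulged_basisState [Nonempty X] [Nonempty Y] {α : X → Y → Fin a → Bool}
    {β : X → Y → Fin b → Bool} (hα : KnownToAl h α) (hβ : KnownToBob h β) :
    qDivulged (fun x y => basisState (α x y) (β x y)) h = 0 := by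
  have divulged_zero (μ : stdSimplex ℝ (X × Y)) :
      max (qDivulgedToBob (fun x y => basisState (α x y) (β x y)) h μ : EReal)
        (qDivulgedToAl (fun x y => basisState (α x y) (β x y)) h μ : EReal) = 0 := by
    simp only [qDivulgedToBob, qDivulgedToAl, reducedBob_basisState, reducedAl_basisState]
    rw [qCondMutualInfo_cqState_diagonal_eq_zero fun x x' y hxx' => by rw [hβ x x' y hxx'],
      qCondMutualInfo_cqState_diagonal_eq_zero fun y y' x hyy' => by rw [hα x y y' hyy']]
    exact max_self _
  simp only [qDivulged, divulged_zero]
  exact ciSup_const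

/-- When both registers contain the basis state labelled by `k x y`, some further rounds compute
`h` without error and without privacy loss. -/
def LosslesslyCompletable (h : X → Y → W) (k : X → Y → Fin N → Bool) : Prop :=
  ∃ R : QuantumRounds X Y W N N,
    (∀ x y, R.successProb x y (h x y) (basisState (k x y) (k x y)) = 1) ∧
      R.lossFrom h (fun x y => basisState (k x y) (k x y)) = 0

variable [Nonempty X] [Nonempty Y]

theorem LosslesslyCompletable.of_determines {k : X → Y → Fin N → Bool} (hAl : KnownToAl h k)
    (hBob : KnownToBob h k)
    (hk : ∀ x y x' y', k x y = k x' y' → h x y = h x' y') : LosslesslyCompletable h k := by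
  have : Nonempty W := .map2 h ‹_› ‹_›
  obtain ⟨g, hg⟩ := (Function.factorsThrough_iff (f := fun p : X × Y => k p.1 p.2)
    fun p => h p.1 p.2).1 fun p q hpq => hk _ _ _ _ hpq
  have hg (x y) : g (k x y) = h x y := (congrFun hg (x, y)).symm
  exact ⟨.output (fun _ => g) fun _ => g,
    fun x y => by rw [successProb_output_basisState, if_pos ⟨hg x y, hg x y⟩],
    qDivulged_basisState hAl hBob⟩

theorem LosslesslyCompletable.of_exchange {k k₁ k₂ : X → Y → Fin N → Bool} (hAl : KnownToAl h k)
    (hBob : KnownToBob h k) (hBob₁ : KnownToBob h k₁)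
    (hk₁ : ∀ x y y', k x y = k x y' ↔ k₁ x y = k₁ x y')
    (hk₂ : ∀ x x' y, k₁ x y = k₁ x' y ∧ k x y = k x' y ↔ k₂ x y = k₂ x' y)
    (hnext : LosslesslyCompletable h k₂) : LosslesslyCompletable h k := by
  obtain ⟨R, hsucc, hloss⟩ := hnext
  choose σ hσ using fun x => exists_perm_apply_eq (hk₁ x)
  have append_eq_iff (x x' y) :
      Fin.append (k₁ x y) (k x y) = Fin.append (k₁ x' y) (k x' y) ↔
        Fin.append (k₂ x y) (k₂ x y) = Fin.append (k₂ x' y) (k₂ x' y) := by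
    change Fin.appendEquiv N N (_, _) = Fin.appendEquiv N N (_, _) ↔
      Fin.appendEquiv N N (_, _) = Fin.appendEquiv N N (_, _)
    simp only [(Fin.appendEquiv N N).injective.eq_iff, Prod.mk_inj, hk₂, and_self]
  choose ρ hρ using fun y => exists_perm_apply_eq fun x x' => append_eq_iff x x' y
  refine ⟨.al (fun x => permUnitary (σ x)) (Equiv.sumEmpty (Fin N) (Fin 0)).symm
    (.bob (fun y => permUnitary (ρ y)) finSumFinEquiv.symm R), fun x y => ?_, ?_⟩
  · simp only [QuantumRounds.successProb, applyAl_permUnitary, hσ, sendAl_sumEmpty_symm,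
      applyBob_permUnitary, hρ, sendBob_finSumFinEquiv_symm, hsucc]
  · have hsent : KnownToBob h fun x y => Fin.append (k₁ x y) (k x y) := fun x x' y hxx' =>
      congrArg₂ Fin.append (hBob₁ x x' y hxx') (hBob x x' y hxx')
    have hnothing : KnownToAl h fun _ _ => (fun j => j.elim0 : Fin 0 → Bool) :=
      fun _ _ _ _ => rfl
    simp only [QuantumRounds.lossFrom, applyAl_permUnitary, hσ, sendAl_sumEmpty_symm,
      applyBob_permUnitary, hρ, sendBob_finSumFinEquiv_symm, hloss, qDivulged_basisState hAl hBob,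
      qDivulged_basisState hnothing hsent, max_self]

theorem Decomposable.losslesslyCompletable {L : Type*} [Fintype L] {m : ℕ} {k : X → Y → L}
    (enc : L ↪ (Fin N → Bool)) (hN : Fintype.card L * 4 ^ m ≤ 2 ^ N)
    (hD : ∀ l, Decomposable h m {x | ∃ y, k x y = l} {y | ∃ x, k x y = l})
    (hAl : KnownToAl h k) (hBob : KnownToBob h k) :
    LosslesslyCompletable h fun x y => enc (k x y) := by
  induction m generalizing L with
  | zero =>
    refine .of_determines (hAl.map enc) (hBob.map enc) fun x y x' y' heq => ?_
    have heq : k x y = k x' y' := enc.injective heq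
    exact hD (k x' y') x ⟨y, heq⟩ y ⟨x, heq⟩ x' ⟨y', rfl⟩ y' ⟨x', rfl⟩
  | succ m ih =>
    obtain ⟨c, d, hkc, hc, hcd, hd, hD⟩ := Decomposable.exists_announcements hD hAl hBob
    have hcard : Fintype.card (L × Bool × Bool) * 4 ^ m ≤ 2 ^ N := by
      simpa [pow_succ', mul_assoc] using hN
    obtain ⟨enc'⟩ : Nonempty (L × Bool × Bool ↪ (Fin N → Bool)) :=
      Function.Embedding.nonempty_of_card_le <|
        (Nat.le_mul_of_pos_right _ (by positivity)).trans (hcard.trans_eq (by simp))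
    have hkc_bob : KnownToBob h fun x y => (k x y, c x y) := fun x x' y hxx' =>
      Prod.ext (hBob x x' y hxx') (hc x x' y hxx')
    refine .of_exchange (k₁ := fun x y => enc' (k x y, c x y, false)) (hAl.map enc) (hBob.map enc)
      (hkc_bob.map fun p => enc' (p.1, p.2, false)) (fun x y y' => ?_) (fun x x' y => ?_)
      (ih enc' hcard hD (fun x y y' hyy' => ?_) (fun x x' y hxx' => ?_))
    · simpa using hkc x y y'
    · have := fun hk hc => hcd x x' y (Prod.ext hk hc)
      simp only [EmbeddingLike.apply_eq_iff_eq, Prod.mk_inj]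
      tauto
    · rw [hAl x y y' hyy', hkc x y y' (hAl x y y' hyy'), hd x y y' hyy']
    · rw [hBob x x' y hxx', hc x x' y hxx', hcd x x' y (hkc_bob x x' y hxx')]

end Rounds

theorem Decomposable.quantumPrivate {X Y : Type*} [Fintype X] [Fintype Y] [DecidableEq X]
    [DecidableEq Y] [Nonempty X] [Nonempty Y] {W : Type} [Fintype W] [DecidableEq W]
    {h : X → Y → W} {m : ℕ} (hD : Decomposable h m Set.univ Set.univ) {ε : ℝ} (hε : 0 ≤ ε) :
    QuantumPrivate ε h := by
  let enc : Unit ↪ (Fin (2 * m) → Bool) := ⟨fun _ _ => false, fun _ _ _ => rfl⟩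
  obtain ⟨R, hsucc, hloss⟩ := Decomposable.losslesslyCompletable (k := fun _ _ => ()) enc
    (by simp [pow_mul]) (fun _ => hD.mono (Set.subset_univ _) (Set.subset_univ _))
    (fun _ _ _ _ => rfl) (fun _ _ _ _ => rfl)
  refine ⟨⟨2 * m, 2 * m, R⟩, fun x y => ?_, hloss⟩
  have hsucc : R.successProb x y (h x y) (initialState (2 * m) (2 * m)) = 1 := hsucc x y
  linarith

end QuantumUpperBound

section ClassicalPrivacy

variable {X Y W : Type*}

/-- The distribution of the pair of coin outcomes of both players. -/
def ClassicalProtocol.coinDistribution (P : ClassicalProtocol X Y W) :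
    Fin P.rA × Fin P.rB → ℝ :=
  fun r => P.pA.1 r.1 * P.pB.1 r.2

/-- What Al holds after `t` bits of communication besides his input. -/
def ClassicalProtocol.alView (P : ClassicalProtocol X Y W) (t : ℕ) (x : X) (y : Y) :
    Fin P.rA × Fin P.rB → Fin P.rA × List Bool :=
  fun r => (r.1, (P.tree.transcript x y r.1 r.2).take t)

/-- What Bob holds after `t` bits of communication besides his input. -/
def ClassicalProtocol.bobView (P : ClassicalProtocol X Y W) (t : ℕ) (x : X) (y : Y) :
    Fin P.rA × Fin P.rB → Fin P.rB × List Bool :=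
  fun r => (r.2, (P.tree.transcript x y r.1 r.2).take t)

theorem ClassicalProtocol.coinDistribution_nonneg (P : ClassicalProtocol X Y W)
    (r : Fin P.rA × Fin P.rB) : 0 ≤ P.coinDistribution r :=
  mul_nonneg (P.pA.2.1 _) (P.pB.2.1 _)

theorem ClassicalProtocol.sum_coinDistribution (P : ClassicalProtocol X Y W) :
    ∑ r, P.coinDistribution r = 1 := by
  rw [Fintype.sum_prod_type]
  simp only [coinDistribution]
  rw [← Finset.sum_mul_sum, P.pA.2.2, P.pB.2.2, one_mul]

variable [Fintype X] [Fintype Y]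

theorem ClassicalProtocol.joint_eq (P : ClassicalProtocol X Y W) (μ : stdSimplex ℝ (X × Y)) :
    P.joint μ = fun ω => μ.1 (ω.1, ω.2.1) * P.coinDistribution ω.2.2 :=
  funext fun _ => mul_assoc _ _ _

variable [DecidableEq X] [DecidableEq Y] [DecidableEq W]

theorem ClassicalProtocol.divulgedToBob_eq_divulged (P : ClassicalProtocol X Y W) (h : X → Y → W)
    (t : ℕ) (μ : stdSimplex ℝ (X × Y)) : P.divulgedToBob h t μ =
      divulged (fun x y => μ.1 (x, y)) P.coinDistribution (P.bobView t) h := by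
  rw [divulgedToBob, joint_eq]
  rfl

theorem ClassicalProtocol.divulgedToAl_eq_divulged (P : ClassicalProtocol X Y W) (h : X → Y → W)
    (t : ℕ) (μ : stdSimplex ℝ (X × Y)) : P.divulgedToAl h t μ =
      divulged (fun y x => μ.1 (x, y)) P.coinDistribution (fun y x => P.alView t x y)
        fun y x => h x y := by
  let swapInputs : X × Y × Fin P.rA × Fin P.rB ≃ Y × X × Fin P.rA × Fin P.rB :=
    ⟨fun ω => (ω.2.1, ω.1, ω.2.2), fun ω => (ω.2.1, ω.1, ω.2.2), fun _ => rfl, fun _ => rfl⟩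
  rw [divulgedToAl, joint_eq, divulged, ← condMutualInfo_comp_equiv swapInputs]
  rfl

theorem ClassicalProtocol.privacyLoss_eq_zero_iff [Nonempty X] [Nonempty Y] [Finite W]
    {P : ClassicalProtocol X Y W} {h : X → Y → W} : P.privacyLoss h = 0 ↔ ∀ t,
      KnownToAl h (fun x y => law P.coinDistribution (P.alView t x y)) ∧
        KnownToBob h fun x y => law P.coinDistribution (P.bobView t x y) := by
  constructor
  · refine fun hloss t => ⟨fun x y y' hyy' => ?_, fun x x' y hxx' => ?_⟩
    all_goals have hle := iSup_le_iff.1 (iSup_le_iff.1 hloss.le t) stdSimplex.barycenter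
    · have hI := EReal.coe_nonpos.1 ((le_max_right _ _).trans hle)
      rw [divulgedToAl_eq_divulged] at hI
      exact law_eq_of_divulged_nonpos (h := fun y x => h x y)
        (fun y x => barycenter_pos (x, y)) P.coinDistribution_nonneg P.sum_coinDistribution hI hyy'
    · have hI := EReal.coe_nonpos.1 ((le_max_left _ _).trans hle)
      rw [divulgedToBob_eq_divulged] at hI
      exact law_eq_of_divulged_nonpos (fun x y => barycenter_pos (x, y))
        P.coinDistribution_nonneg P.sum_coinDistribution hI hxx'
  · intro hknown
    have divulged_eq (t : ℕ) (μ : stdSimplex ℝ (X × Y)) :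
        max (P.divulgedToBob h t μ : EReal) (P.divulgedToAl h t μ : EReal) = 0 := by
      rw [divulgedToBob_eq_divulged, divulged_eq_zero (hknown t).2, divulgedToAl_eq_divulged,
        divulged_eq_zero (h := fun y x => h x y) fun y y' x => (hknown t).1 x y y']
      exact max_self _
    simp only [privacyLoss, divulged_eq, ciSup_const]

end ClassicalPrivacy

section ClassicalUpperBound

variable {X Y W : Type*} {h : X → Y → W} {S : Set X} {T : Set Y}

theorem ConstantOnRectangle.exists_eq [Nonempty W] (hh : ConstantOnRectangle h S T) :
    ∃ w, ∀ x ∈ S, ∀ y ∈ T, h x y = w := by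
  by_cases hST : ∃ x ∈ S, ∃ y ∈ T, True
  · obtain ⟨x', hx', y', hy', -⟩ := hST
    exact ⟨h x' y', fun x hx y hy => hh x hx y hy x' hx' y' hy'⟩
  · exact ⟨Classical.arbitrary W, fun x hx y hy => absurd ⟨x, hx, y, hy, trivial⟩ hST⟩

theorem Decomposable.exists_tree [Nonempty W] (RA RB : Type) {n : ℕ}
    (hD : Decomposable h n S T) : ∃ t : ProtocolTree X Y W RA RB, ∀ ra rb,
      (∀ x ∈ S, ∀ y ∈ T, t.outputs x y ra rb = (h x y, h x y)) ∧
      (∀ x ∈ S, ∀ y ∈ T, ∀ y' ∈ T, h x y = h x y' →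
        t.transcript x y ra rb = t.transcript x y' ra rb) ∧
      ∀ x ∈ S, ∀ x' ∈ S, ∀ y ∈ T, h x y = h x' y →
        t.transcript x y ra rb = t.transcript x' y ra rb := by
  induction n generalizing S T with
  | zero =>
    obtain ⟨w, hw⟩ := hD.exists_eq
    exact ⟨.output (fun _ _ => w) fun _ _ => w, fun ra rb =>
      ⟨fun x hx y hy => by rw [hw x hx y hy, ProtocolTree.outputs],
        fun _ _ _ _ _ _ _ => rfl, fun _ _ _ _ _ _ _ => rfl⟩⟩
  | succ n ih =>
    obtain ⟨c, hc, hD⟩ := hD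
    choose d hd hD using hD
    choose t ht using fun b b' => ih (hD b b')
    refine ⟨.al (fun x _ => c x) fun b => .bob (fun y _ => d b y) fun b' => t b b',
      fun ra rb => ⟨fun x hx y hy => ?_, fun x hx y hy y' hy' hyy' => ?_,
        fun x hx x' hx' y hy hxx' => ?_⟩⟩
    · exact (ht _ _ ra rb).1 x ⟨hx, rfl⟩ y ⟨hy, rfl⟩
    · have hdy := hd (c x) y hy y' hy' x ⟨hx, rfl⟩ hyy'
      simp only [ProtocolTree.transcript, hdy]
      rw [(ht _ _ ra rb).2.1 x ⟨hx, rfl⟩ y ⟨hy, hdy⟩ y' ⟨hy', rfl⟩ hyy']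
    · have hcx := hc x hx x' hx' y hy hxx'
      simp only [ProtocolTree.transcript, hcx]
      rw [(ht _ _ ra rb).2.2 x ⟨hx, hcx⟩ x' ⟨hx', rfl⟩ y ⟨hy, rfl⟩ hxx']

theorem Decomposable.deterministicallyPrivate {W : Type} [Finite W] [DecidableEq W] [Fintype X]
    [Fintype Y] [DecidableEq X] [DecidableEq Y] [Nonempty X] [Nonempty Y] {h : X → Y → W} {n : ℕ}
    (hD : Decomposable h n Set.univ Set.univ) : DeterministicallyPrivate h := by
  have : Nonempty W := ⟨h (Classical.arbitrary X) (Classical.arbitrary Y)⟩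
  obtain ⟨t, ht⟩ := hD.exists_tree (Fin 1) (Fin 1)
  let coin : stdSimplex ℝ (Fin 1) := ⟨fun _ => 1, fun _ => zero_le_one, by simp⟩
  refine ⟨⟨1, 1, coin, coin, t⟩, ⟨rfl, rfl⟩, fun x y => ?_,
    ClassicalProtocol.privacyLoss_eq_zero_iff.2 fun k => ⟨fun x y y' hyy' => ?_,
      fun x x' y hxx' => ?_⟩⟩
  · simp [coin, (ht _ _).1 x trivial y trivial]
  · refine congrArg (law _) (funext fun r => ?_)
    simp only [ClassicalProtocol.alView, (ht r.1 r.2).2.1 x trivial y trivial y' trivial hyy']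
  · refine congrArg (law _) (funext fun r => ?_)
    simp only [ClassicalProtocol.bobView, (ht r.1 r.2).2.2 x trivial x' trivial y trivial hxx']

end ClassicalUpperBound

section ClassicalLowerBound

variable {X Y W V RA RB : Type*}

theorem ConstantOnRectangle.transpose {h : X → Y → W} {S : Set X} {T : Set Y}
    (hh : ConstantOnRectangle h S T) : ConstantOnRectangle (fun y x => h x y) T S :=
  fun y hy x hx y' hy' x' hx' => hh x hx y hy x' hx' y' hy'

theorem mul_eq_mul_of_le {α α' β β' : ℝ} (h0 : 0 ≤ α') (hle : α' ≤ α) (h : α * β = α * β') :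
    α' * β = α' * β' := by
  rcases mul_eq_mul_left_iff.1 h with h | h
  · rw [h]
  · rw [le_antisymm (hle.trans h.le) h0, zero_mul, zero_mul]

theorem RowConnected.constantOnRectangle_mul {h : X → Y → W} {S : Set X} {T : Set Y}
    (hS : RowConnected h S T) {α α' : X → ℝ} {β : Y → ℝ} (h0 : ∀ x, 0 ≤ α' x)
    (hle : ∀ x, α' x ≤ α x) (hconst : ConstantOnRectangle (fun x y => α x * β y) S T)
    (hknown : KnownToBob h fun x y => α' x * β y) :
    ConstantOnRectangle (fun x y => α' x * β y) S T := by
  intro x hx y hy x' hx' y' hy'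
  have hcol {x} (hx : x ∈ S) {y} (hy : y ∈ T) : α' x * β y = α' x * β y' :=
    mul_eq_mul_of_le (h0 x) (hle x) (hconst x hx y hy x hx y' hy')
  refine (hcol hx hy).trans (hS.apply_eq (fun x => α' x * β y') ?_ hx hx')
  intro z hz z' hz' w hw hzz'
  rw [← hcol hz hw, ← hcol hz' hw]
  exact hknown z z' w hzz'

/-- The weights of those coin outcomes for which the next bit sent is `c`. -/
def restrictCoins (bit : X → RA → Bool) (c : Bool) (a : X → RA → ℝ) : X → RA → ℝ :=
  fun x ra => if bit x ra = c then a x ra else 0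

theorem restrictCoins_nonneg {a : X → RA → ℝ} (ha : ∀ x ra, 0 ≤ a x ra) (bit : X → RA → Bool)
    (c : Bool) (x : X) (ra : RA) : 0 ≤ restrictCoins bit c a x ra := by
  unfold restrictCoins
  split_ifs
  exacts [ha x ra, le_rfl]

theorem sum_restrictCoins_le [Fintype RA] {a : X → RA → ℝ} (ha : ∀ x ra, 0 ≤ a x ra)
    (bit : X → RA → Bool) (c : Bool) (x : X) :
    ∑ ra, restrictCoins bit c a x ra ≤ ∑ ra, a x ra :=
  Finset.sum_le_sum fun ra _ => by
    unfold restrictCoins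
    split_ifs
    exacts [le_rfl, ha x ra]

namespace ProtocolTree

variable {RA RB : Type} [Fintype RA] [Fintype RB] [DecidableEq V]

/-- The weight of the coin outcomes for which the bits `q` are sent first, when the coins of Al and
Bob are weighted by `a` and `b`. The weights may depend on the inputs, because they are restricted
to the coins consistent with the bits sent so far. -/
def prefixWeight (t : ProtocolTree X Y W RA RB) (a : X → RA → ℝ) (b : Y → RB → ℝ)
    (q : List Bool) (x : X) (y : Y) : ℝ :=
  law (fun r : RA × RB => a x r.1 * b y r.2)
    (fun r => (t.transcript x y r.1 r.2).take q.length) q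

/-- The weight of the coin outcomes for which the outputs have the image `v` under `g`, when the
coins of Al and Bob are weighted by `a` and `b`. -/
def outputWeight (t : ProtocolTree X Y W RA RB) (a : X → RA → ℝ) (b : Y → RB → ℝ) (g : W × W → V)
    (v : V) (x : X) (y : Y) : ℝ :=
  law (fun r : RA × RB => a x r.1 * b y r.2) (fun r => g (t.outputs x y r.1 r.2)) v

/-- No player learns anything from the bits sent, in terms of the weights of their prefixes. -/
def IsPrivate (t : ProtocolTree X Y W RA RB) (a : X → RA → ℝ) (b : Y → RB → ℝ)
    (h : X → Y → W) : Prop :=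
  ∀ q, KnownToAl h (t.prefixWeight a b q) ∧ KnownToBob h (t.prefixWeight a b q)

variable (a : X → RA → ℝ) (b : Y → RB → ℝ)

theorem prefixWeight_nil (t : ProtocolTree X Y W RA RB) (x : X) (y : Y) :
    t.prefixWeight a b [] x y = (∑ ra, a x ra) * ∑ rb, b y rb := by
  simp [prefixWeight, law, Finset.sum_mul_sum, Fintype.sum_prod_type]

theorem prefixWeight_al (bit : X → RA → Bool) (next : Bool → ProtocolTree X Y W RA RB) (c : Bool)
    (q : List Bool) : (al bit next).prefixWeight a b (c :: q) =
      (next c).prefixWeight (restrictCoins bit c a) b q := by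
  funext x y
  simp only [prefixWeight, law, Finset.sum_filter]
  refine Finset.sum_congr rfl fun r _ => ?_
  by_cases hc : bit x r.1 = c <;> simp [transcript, restrictCoins, hc]

theorem prefixWeight_bob (bit : Y → RB → Bool) (next : Bool → ProtocolTree X Y W RA RB) (c : Bool)
    (q : List Bool) : (bob bit next).prefixWeight a b (c :: q) =
      (next c).prefixWeight a (restrictCoins bit c b) q := by
  funext x y
  simp only [prefixWeight, law, Finset.sum_filter]
  refine Finset.sum_congr rfl fun r _ => ?_
  by_cases hc : bit y r.2 = c <;> simp [transcript, restrictCoins, hc]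

theorem outputWeight_al (bit : X → RA → Bool) (next : Bool → ProtocolTree X Y W RA RB)
    (g : W × W → V) (v : V) (x : X) (y : Y) : (al bit next).outputWeight a b g v x y =
      ∑ c, (next c).outputWeight (restrictCoins bit c a) b g v x y := by
  simp only [outputWeight, law, Finset.sum_filter, Fintype.sum_bool, ← Finset.sum_add_distrib]
  refine Finset.sum_congr rfl fun r _ => ?_
  cases hc : bit x r.1 <;> simp [outputs, restrictCoins, hc]

theorem outputWeight_bob (bit : Y → RB → Bool) (next : Bool → ProtocolTree X Y W RA RB)
    (g : W × W → V) (v : V) (x : X) (y : Y) : (bob bit next).outputWeight a b g v x y =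
      ∑ c, (next c).outputWeight a (restrictCoins bit c b) g v x y := by
  simp only [outputWeight, law, Finset.sum_filter, Fintype.sum_bool, ← Finset.sum_add_distrib]
  refine Finset.sum_congr rfl fun r _ => ?_
  cases hc : bit y r.2 <;> simp [outputs, restrictCoins, hc]

theorem outputWeight_output_fst [DecidableEq W] (outA : X → RA → W) (outB : Y → RB → W) (w : W)
    (x : X) (y : Y) : (output outA outB).outputWeight a b Prod.fst w x y =
      ∑ ra with outA x ra = w, a x ra * ∑ rb, b y rb := by
  rw [outputWeight, law, Finset.sum_filter, Finset.sum_filter, Fintype.sum_prod_type]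
  refine Finset.sum_congr rfl fun ra _ => ?_
  by_cases hw : outA x ra = w <;> simp [outputs, hw, Finset.mul_sum]

theorem outputWeight_output_snd [DecidableEq W] (outA : X → RA → W) (outB : Y → RB → W) (w : W)
    (x : X) (y : Y) : (output outA outB).outputWeight a b Prod.snd w x y =
      ∑ rb with outB y rb = w, b y rb * ∑ ra, a x ra := by
  rw [outputWeight, law, Finset.sum_filter, Finset.sum_filter, Fintype.sum_prod_type_right]
  refine Finset.sum_congr rfl fun rb _ => ?_
  by_cases hw : outB y rb = w <;> simp [outputs, hw, Finset.mul_sum, mul_comm]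

variable {a b} {h : X → Y → W} {S : Set X} {T : Set Y}

theorem IsPrivate.al {bit : X → RA → Bool} {next : Bool → ProtocolTree X Y W RA RB}
    (ht : (al bit next).IsPrivate a b h) (c : Bool) :
    (next c).IsPrivate (restrictCoins bit c a) b h :=
  fun q => by simpa only [prefixWeight_al] using ht (c :: q)

theorem IsPrivate.bob {bit : Y → RB → Bool} {next : Bool → ProtocolTree X Y W RA RB}
    (ht : (bob bit next).IsPrivate a b h) (c : Bool) :
    (next c).IsPrivate a (restrictCoins bit c b) h :=
  fun q => by simpa only [prefixWeight_bob] using ht (c :: q)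

theorem constantOnRectangle_prefixWeight_al (hS : RowConnected h S T) (ha : ∀ x ra, 0 ≤ a x ra)
    {bit : X → RA → Bool} {next : Bool → ProtocolTree X Y W RA RB}
    (hconst : ConstantOnRectangle ((al bit next).prefixWeight a b []) S T)
    (hprivate : (al bit next).IsPrivate a b h) (c : Bool) :
    ConstantOnRectangle ((next c).prefixWeight (restrictCoins bit c a) b []) S T := by
  have hknown := (hprivate.al c []).2
  simp only [funext₂ (prefixWeight_nil _ _ _)] at hconst hknown ⊢
  exact hS.constantOnRectangle_mul
    (fun x => Finset.sum_nonneg fun ra _ => restrictCoins_nonneg ha bit c x ra)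
    (sum_restrictCoins_le ha bit c) hconst hknown

theorem constantOnRectangle_prefixWeight_bob (hT : RowConnected (fun y x => h x y) T S)
    (hb : ∀ y rb, 0 ≤ b y rb) {bit : Y → RB → Bool} {next : Bool → ProtocolTree X Y W RA RB}
    (hconst : ConstantOnRectangle ((bob bit next).prefixWeight a b []) S T)
    (hprivate : (bob bit next).IsPrivate a b h) (c : Bool) :
    ConstantOnRectangle ((next c).prefixWeight a (restrictCoins bit c b) []) S T := by
  have hknown := (hprivate.bob c []).1
  have total_eq (b : Y → RB → ℝ) (t : ProtocolTree X Y W RA RB) :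
      t.prefixWeight a b [] = fun x y => (∑ rb, b y rb) * ∑ ra, a x ra :=
    funext₂ fun x y => (prefixWeight_nil a b t x y).trans (mul_comm _ _)
  rw [total_eq] at hconst hknown ⊢
  exact (hT.constantOnRectangle_mul
    (fun y => Finset.sum_nonneg fun rb _ => restrictCoins_nonneg hb bit c y rb)
    (sum_restrictCoins_le hb bit c) hconst.transpose fun y y' x => hknown x y y').transpose

theorem outputWeight_eq [DecidableEq W] (hS : RowConnected h S T)
    (hT : RowConnected (fun y x => h x y) T S) (t : ProtocolTree X Y W RA RB)
    (ha : ∀ x ra, 0 ≤ a x ra) (hb : ∀ y rb, 0 ≤ b y rb)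
    (hconst : ConstantOnRectangle (t.prefixWeight a b []) S T) (hprivate : t.IsPrivate a b h)
    (w : W) : (∀ x ∈ S, ∀ y ∈ T, ∀ y' ∈ T,
        t.outputWeight a b Prod.fst w x y = t.outputWeight a b Prod.fst w x y') ∧
      ∀ x ∈ S, ∀ x' ∈ S, ∀ y ∈ T,
        t.outputWeight a b Prod.snd w x y = t.outputWeight a b Prod.snd w x' y := by
  induction t generalizing a b with
  | output outA outB =>
    simp only [funext₂ (prefixWeight_nil _ _ _)] at hconst
    simp only [outputWeight_output_fst, outputWeight_output_snd]
    refine ⟨fun x hx y hy y' hy' => Finset.sum_congr rfl fun ra _ => ?_,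
      fun x hx x' hx' y hy => Finset.sum_congr rfl fun rb _ => ?_⟩
    · exact mul_eq_mul_of_le (ha x ra)
        (Finset.single_le_sum (fun r _ => ha x r) (Finset.mem_univ ra))
        (hconst x hx y hy x hx y' hy')
    · refine mul_eq_mul_of_le (hb y rb)
        (Finset.single_le_sum (fun r _ => hb y r) (Finset.mem_univ rb)) ?_
      simpa only [mul_comm] using hconst x hx y hy x' hx' y hy
  | al bit next ih =>
    simp only [outputWeight_al]
    have next_eq (c : Bool) := ih c (restrictCoins_nonneg ha bit c) hb
      (constantOnRectangle_prefixWeight_al hS ha hconst hprivate c) (hprivate.al c)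
    exact ⟨fun x hx y hy y' hy' => Finset.sum_congr rfl fun c _ => (next_eq c).1 x hx y hy y' hy',
      fun x hx x' hx' y hy => Finset.sum_congr rfl fun c _ => (next_eq c).2 x hx x' hx' y hy⟩
  | bob bit next ih =>
    simp only [outputWeight_bob]
    have next_eq (c : Bool) := ih c ha (restrictCoins_nonneg hb bit c)
      (constantOnRectangle_prefixWeight_bob hT hb hconst hprivate c) (hprivate.bob c)
    exact ⟨fun x hx y hy y' hy' => Finset.sum_congr rfl fun c _ => (next_eq c).1 x hx y hy y' hy',
      fun x hx x' hx' y hy => Finset.sum_congr rfl fun c _ => (next_eq c).2 x hx x' hx' y hy⟩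

end ProtocolTree

namespace ClassicalProtocol

variable [DecidableEq W] {P : ClassicalProtocol X Y W} {h : X → Y → W}

theorem isPrivate_tree [Finite W] [Fintype X] [Fintype Y] [DecidableEq X] [DecidableEq Y]
    [Nonempty X] [Nonempty Y] (hloss : P.privacyLoss h = 0) :
    P.tree.IsPrivate (fun _ => P.pA.1) (fun _ => P.pB.1) h := fun q =>
  have hknown := privacyLoss_eq_zero_iff.1 hloss q.length
  ⟨fun x y y' hyy' => congrFun (law_comp_congr (hknown.1 x y y' hyy') Prod.snd) q,
    fun x x' y hxx' => congrFun (law_comp_congr (hknown.2 x x' y hxx') Prod.snd) q⟩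

theorem half_lt_outputWeight {ε : ℝ} (hε : ε < 1 / 2) (hP : P.Computes ε h) {g : W × W → W}
    (hg : ∀ w, g (w, w) = w) (x : X) (y : Y) :
    1 / 2 < P.tree.outputWeight (fun _ => P.pA.1) (fun _ => P.pB.1) g (h x y) x y := by
  have hsucc := hP x y
  rw [← Fintype.sum_prod_type' (f := fun ra rb =>
    if P.tree.outputs x y ra rb = (h x y, h x y) then P.pA.1 ra * P.pB.1 rb else 0),
    ← Finset.sum_filter] at hsucc
  refine lt_of_lt_of_le (by linarith) (hsucc.trans ?_)
  refine Finset.sum_le_sum_of_subset_of_nonneg (fun r hr => ?_)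
    fun r _ _ => P.coinDistribution_nonneg r
  simp only [Finset.mem_filter_univ] at hr ⊢
  rw [hr, hg]

theorem noForbiddenRectangle [Finite W] [Fintype X] [Fintype Y] [DecidableEq X] [DecidableEq Y]
    {ε : ℝ} (hε : ε < 1 / 2) (hP : P.Computes ε h) (hloss : P.privacyLoss h = 0) :
    NoForbiddenRectangle h := by
  intro S T hS hT x hx y hy x' hx' y' hy'
  have : Nonempty X := ⟨x⟩
  have : Nonempty Y := ⟨y⟩
  have weight_eq := P.tree.outputWeight_eq hS hT (fun _ => P.pA.2.1) (fun _ => P.pB.2.1)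
    (fun _ _ _ _ _ _ _ _ => by simp only [ProtocolTree.prefixWeight_nil]) (isPrivate_tree hloss)
  have row_eq : h x y = h x y' :=
    eq_of_half_lt P.coinDistribution_nonneg P.sum_coinDistribution _
      (half_lt_outputWeight hε hP (g := Prod.fst) (fun _ => rfl) x y)
      ((half_lt_outputWeight hε hP (fun _ => rfl) x y').trans_eq
        ((weight_eq _).1 x hx y' hy' y hy))
  have column_eq : h x y' = h x' y' :=
    eq_of_half_lt P.coinDistribution_nonneg P.sum_coinDistribution _
      (half_lt_outputWeight hε hP (g := Prod.snd) (fun _ => rfl) x y')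
      ((half_lt_outputWeight hε hP (fun _ => rfl) x' y').trans_eq
        ((weight_eq _).2 x' hx' x hx y' hy'))
  exact row_eq.trans column_eq

end ClassicalProtocol

end ClassicalLowerBound

section Hint

section Characterization

variable {X Y : Type*} [Fintype X] [Fintype Y] [DecidableEq X] [DecidableEq Y]
  [Nonempty X] [Nonempty Y] {W : Type} [DecidableEq W] {h : X → Y → W} {ε : ℝ}

theorem NoForbiddenRectangle.deterministicallyPrivate [Finite W] (hh : NoForbiddenRectangle h) :
    DeterministicallyPrivate h :=
  have ⟨_, hD⟩ := hh.exists_decomposable Set.univ Set.univ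
  hD.deterministicallyPrivate

theorem classicallyPrivate_iff [Finite W] (hε : 0 ≤ ε) (hε' : ε < 1 / 2) :
    ClassicallyPrivate ε h ↔ NoForbiddenRectangle h := by
  refine ⟨fun ⟨P, hP, hloss⟩ => P.noForbiddenRectangle hε' hP hloss, fun hh => ?_⟩
  obtain ⟨P, -, hP, hloss⟩ := hh.deterministicallyPrivate
  exact ⟨P, fun x y => (sub_le_sub_left hε 1).trans (hP x y), hloss⟩

theorem deterministicallyPrivate_iff [Finite W] :
    DeterministicallyPrivate h ↔ NoForbiddenRectangle h :=
  ⟨fun ⟨_, _, hP, hloss⟩ => (classicallyPrivate_iff le_rfl one_half_pos).1 ⟨_, hP, hloss⟩,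
    NoForbiddenRectangle.deterministicallyPrivate⟩

theorem quantumPrivate_iff [Fintype W] (hε : 0 ≤ ε) (hε' : ε < 1 / 2) :
    QuantumPrivate ε h ↔ NoForbiddenRectangle h := by
  refine ⟨fun ⟨P, hP, hloss⟩ => P.noForbiddenRectangle hε' hP hloss, fun hh => ?_⟩
  obtain ⟨n, hD⟩ := hh.exists_decomposable Set.univ Set.univ
  exact hD.quantumPrivate hε

end Characterization

theorem noForbiddenRectangle_of_injective {X Y W : Type*} {h : X → Y → W}
    (hh : ∀ x y x' y', h x y = h x' y' → x = x' ∧ y = y') : NoForbiddenRectangle h := by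
  intro S T hS hT x hx y hy x' hx' y' hy'
  have hxx' : x = x' := hS.apply_eq id (fun x _ x' _ y _ heq => (hh x y x' y heq).1) hx hx'
  have hyy' : y = y' := hT.apply_eq id (fun y _ y' _ x _ heq => (hh x y x y' heq).2) hy hy'
  rw [hxx', hyy']

variable {X Y Z : Type*}
  {Priv Priv' : ∀ (W : Type) [Fintype W] [DecidableEq W], (X → Y → W) → Prop}

theorem hintComputable_congr
    (hPriv : ∀ (W : Type) [Fintype W] [DecidableEq W] (h : X → Y → W), Priv W h ↔ Priv' W h)
    (f : X → Y → Z) (k : ℝ) : HintComputable Priv f k ↔ HintComputable Priv' f k := by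
  simp only [HintComputable, hPriv]

theorem hintPrivacyLoss_congr
    (hPriv : ∀ (W : Type) [Fintype W] [DecidableEq W] (h : X → Y → W), Priv W h ↔ Priv' W h)
    (f : X → Y → Z) : hintPrivacyLoss Priv f = hintPrivacyLoss Priv' f := by
  simp only [hintPrivacyLoss, hintComputable_congr hPriv]

variable [Finite X] [Finite Y] [Nonempty X] [Nonempty Y] {f : X → Y → Z}

theorem HintComputable.nonneg {k : ℝ} (hk : HintComputable Priv f k) : 0 ≤ k := by
  obtain ⟨W, _, _, h, -, ⟨g, hg⟩, rfl⟩ := hk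
  have range_eq : (Set.range fun p : X × Y => f p.1 p.2) =
      g '' Set.range fun p : X × Y => h p.1 p.2 := by
    simp only [hg, ← Set.range_comp, Function.comp_def]
  have hpos : 0 < (Set.range fun p : X × Y => f p.1 p.2).ncard :=
    (Set.ncard_pos (Set.finite_range _)).2 (Set.range_nonempty _)
  have hle : (Set.range fun p : X × Y => f p.1 p.2).ncard ≤
      (Set.range fun p : X × Y => h p.1 p.2).ncard :=
    range_eq ▸ Set.ncard_image_le (Set.finite_range _)
  exact sub_nonneg.2 (Real.logb_le_logb_of_le one_lt_two (by exact_mod_cast hpos)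
    (by exact_mod_cast hle))

theorem HintComputable.exists_hintPrivacyLoss_eq_coe {k : ℝ} (hk : HintComputable Priv f k) :
    ∃ k : ℝ, hintPrivacyLoss Priv f = k := by
  have hle : hintPrivacyLoss Priv f ≤ k := iInf₂_le k hk
  have hnonneg : 0 ≤ hintPrivacyLoss Priv f := le_iInf₂ fun _ hk => EReal.coe_nonneg.2 hk.nonneg
  exact ⟨_, (EReal.coe_toReal (ne_top_of_le_ne_top (EReal.coe_ne_top k) hle)
    (ne_bot_of_le_ne_bot EReal.zero_ne_bot hnonneg)).symm⟩

theorem exists_hintPrivacyLoss_noForbiddenRectangle_eq_coe (f : X → Y → Z) :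
    ∃ k : ℝ, hintPrivacyLoss (fun _ _ _ h => NoForbiddenRectangle h) f = k := by
  let eX := Finite.equivFin X
  let eY := Finite.equivFin Y
  refine HintComputable.exists_hintPrivacyLoss_eq_coe ⟨_, inferInstance, inferInstance,
    fun x y => (eX x, eY y), noForbiddenRectangle_of_injective (by simp),
    ⟨fun w => f (eX.symm w.1) (eY.symm w.2), by simp⟩, rfl⟩

end Hint

end TwoParty

end

theorem mainTheorem12 {X Y Z : Type*} [Fintype X] [Fintype Y] [DecidableEq X] [DecidableEq Y]
    [Nonempty X] [Nonempty Y] (f : X → Y → Z) (ε₁ ε₂ : ℝ)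
    (hε₁ : 0 ≤ ε₁) (hε₁' : ε₁ < 1 / 2) (hε₂ : 0 ≤ ε₂) (hε₂' : ε₂ < 1 / 2) :
    (∀ k : ℝ,
      (TwoParty.HintComputable (fun _ _ _ h => TwoParty.ClassicallyPrivate ε₁ h) f k ↔
        TwoParty.HintComputable (fun _ _ _ h => TwoParty.DeterministicallyPrivate h) f k) ∧
      (TwoParty.HintComputable (fun _ _ _ h => TwoParty.QuantumPrivate ε₂ h) f k ↔
        TwoParty.HintComputable (fun _ _ _ h => TwoParty.ClassicallyPrivate ε₁ h) f k)) ∧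
    ∃ k : ℝ, TwoParty.deterministicHintLoss f = k ∧ TwoParty.classicalHintLoss ε₁ f = k ∧
      TwoParty.quantumHintLoss ε₂ f = k := by
  have deterministic (W : Type) [Fintype W] [DecidableEq W] (h : X → Y → W) :
      TwoParty.DeterministicallyPrivate h ↔ TwoParty.NoForbiddenRectangle h :=
    TwoParty.deterministicallyPrivate_iff
  have classical (W : Type) [Fintype W] [DecidableEq W] (h : X → Y → W) :
      TwoParty.ClassicallyPrivate ε₁ h ↔ TwoParty.NoForbiddenRectangle h :=
    TwoParty.classicallyPrivate_iff hε₁ hε₁'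
  have quantum (W : Type) [Fintype W] [DecidableEq W] (h : X → Y → W) :
      TwoParty.QuantumPrivate ε₂ h ↔ TwoParty.NoForbiddenRectangle h :=
    TwoParty.quantumPrivate_iff hε₂ hε₂'
  obtain ⟨k, hk⟩ := TwoParty.exists_hintPrivacyLoss_noForbiddenRectangle_eq_coe f
  refine ⟨fun k => ?_, k, ?_, ?_, ?_⟩
  · simp only [TwoParty.HintComputable, deterministic, classical, quantum, and_self]
  · exact (TwoParty.hintPrivacyLoss_congr deterministic f).trans hk
  · exact (TwoParty.hintPrivacyLoss_congr classical f).trans hk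
  · exact (TwoParty.hintPrivacyLoss_congr quantum f).trans hk
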